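/- Fix an integer $k\ge 2$ and let $R=\mathbb{C}[x,y]/(x^k)$, $\mathbb{Z}$-graded with $x$ in degree $1$ and $y$ in degree $-1$. For a graded $R$-module $M$ and $j\in\mathbb{Z}$ let $M(j)$ be the shifted module with $M(j)_i=M_{i+j}$. For a $k$-element subset $\underline\ell=\{\ell_1<\dots<\ell_k\}$ of $\mathbb{Z}$ let $$I(\underline\ell)=\bigl(x^{p-1}y^{\,\ell_k-\ell_p-(k-p)} \;:\; 1\le p\le k\bigr)\,(k-1-\ell_k),$$ the graded ideal of $R$ generated by the displayed monomials, shifted by $k-1-\ell_k$. Let $\mathrm{Ext}^1$ denote the complex vector space of classes of extensions in the category of $\mathbb{Z}$-graded $R$-modules and degree-preserving $R$-linear maps. (For the modules $I(\underline\ell)$ this is the same as $\mathrm{Ext}^1$ in the full, extension-closed subcategory of finitely generated $\mathbb{Z}$-graded maximal Cohen–Macaulay $R$-modules.) Then for any two $k$-element subsets $\underline\ell,\underline m$ of $\mathbb{Z}$ the complex vector spaces $\mathrm{Ext}^1(I(\underline\ell),I(\underline m))$ and $\mathrm{Ext}^1(I(\underline m),I(\underline\ell))$ are finite-dimensional, and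 $$\dim_{\mathbb{C}}\mathrm{Ext}^1(I(\underline\ell),I(\underline m))=\dim_{\mathbb{C}}\mathrm{Ext}^1(I(\underline m),I(\underline\ell)).$$ -/

import Mathlib

open CategoryTheory CategoryTheory.Limits

noncomputable section

namespace GrassmannInfinite

/-! ### Gradings of complex vector spaces by the integers -/

section Grading

variable {V : Type} [AddCommGroup V] [Module ℂ V]

/-- The projection of `V = ⨁ i, p i` onto its homogeneous component of degree `i`. -/
def proj {p : ℤ → Submodule ℂ V} (h : DirectSum.IsInternal p) (i : ℤ) : V →ₗ[ℂ] V :=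
  (p i).subtype ∘ₗ DirectSum.component ℂ ℤ (fun j => p j) i ∘ₗ
    (LinearEquiv.ofBijective (DirectSum.coeLinearMap p) h).symm.toLinearMap

variable {p : ℤ → Submodule ℂ V} (h : DirectSum.IsInternal p)

theorem proj_mem (i : ℤ) (v : V) : proj h i v ∈ p i := by
  simp [proj]

theorem proj_same {i : ℤ} {v : V} (hv : v ∈ p i) : proj h i v = v := by
  exact congrArg Subtype.val (h.ofBijective_coeLinearMap_of_mem hv)

theorem proj_ne {i j : ℤ} (hij : i ≠ j) {v : V} (hv : v ∈ p i) : proj h j v = 0 := by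
  exact congrArg Subtype.val (h.ofBijective_coeLinearMap_of_mem_ne hij hv)

theorem mem_of_proj_mem (W : Submodule ℂ V) (v : V) (hv : ∀ i, proj h i v ∈ W) : v ∈ W := by
  obtain ⟨x, rfl⟩ := h.2 v
  have key : ∀ i, proj h i (DirectSum.coeAddMonoidHom p x) = (x i : V) := by
    intro i
    have : (LinearEquiv.ofBijective (DirectSum.coeLinearMap p) h).symm
        (DirectSum.coeAddMonoidHom p x) = x :=
      (LinearEquiv.ofBijective (DirectSum.coeLinearMap p) h).symm_apply_apply x
    simp only [proj, LinearMap.comp_apply, LinearEquiv.coe_coe, this]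
    rfl
  classical
  rw [DirectSum.coeAddMonoidHom_eq_dfinsuppSum]
  refine Submodule.sum_mem _ fun i _ => ?_
  have hi := hv i
  rw [key i] at hi
  exact hi

theorem isInternal_of_proj {p : ℤ → Submodule ℂ V} (π : ℤ → V →ₗ[ℂ] V)
    (hsame : ∀ i v, v ∈ p i → π i v = v) (hne : ∀ i j v, i ≠ j → v ∈ p i → π j v = 0)
    (hsup : ⨆ i, p i = ⊤) : DirectSum.IsInternal p := by
  refine DirectSum.isInternal_submodule_of_iSupIndep_of_iSup_eq_top ?_ hsup
  intro i
  rw [Submodule.disjoint_def]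
  intro x hx hx'
  have : (⨆ (j) (_ : j ≠ i), p j) ≤ LinearMap.ker (π i) :=
    iSup₂_le fun j hj v hv => hne j i v hj hv
  rw [← hsame i x hx]
  exact this hx'

end Grading

/-! ### The abelian category of graded modules -/

variable {A : Type} [CommRing A] [Algebra ℂ A]

/-- A `ℤ`-graded module over the commutative `ℂ`-algebra `A` with grading `𝒜`.  The `ℂ`-vector
space structure is the one obtained from `A` by restriction of scalars. -/
structure GrMod (𝒜 : ℤ → Submodule ℂ A) : Type 1 where
  carrier : Type
  [addCommGroup : AddCommGroup carrier]
  [moduleBase : Module ℂ carrier]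
  [module : Module A carrier]
  [isScalarTower : IsScalarTower ℂ A carrier]
  /-- the homogeneous component of each degree -/
  piece : ℤ → Submodule ℂ carrier
  isInternal : DirectSum.IsInternal piece
  smul_mem : ∀ {i j : ℤ} {a : A} {v : carrier}, a ∈ 𝒜 i → v ∈ piece j → a • v ∈ piece (i + j)

attribute [instance] GrMod.addCommGroup GrMod.moduleBase GrMod.module GrMod.isScalarTower

namespace GrMod

variable {𝒜 : ℤ → Submodule ℂ A}

/-- Morphisms of graded modules: the `A`-linear maps that preserve degrees, as a complex
subspace of the space of all `A`-linear maps. -/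
def homs (M N : GrMod 𝒜) : Submodule ℂ (M.carrier →ₗ[A] N.carrier) where
  carrier := {f | ∀ i, ∀ v ∈ M.piece i, f v ∈ N.piece i}
  add_mem' hf hg i v hv := (N.piece i).add_mem (hf i v hv) (hg i v hv)
  zero_mem' i _ _ := (N.piece i).zero_mem
  smul_mem' c _ hf i v hv := (N.piece i).smul_mem c (hf i v hv)

instance : Category (GrMod 𝒜) where
  Hom M N := homs M N
  id M := ⟨LinearMap.id, fun _ _ hv => hv⟩
  comp f g := ⟨g.1 ∘ₗ f.1, fun i v hv => g.2 i _ (f.2 i v hv)⟩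

/-- The `A`-linear map underlying a morphism of graded modules. -/
def lin {M N : GrMod 𝒜} (f : M ⟶ N) : M.carrier →ₗ[A] N.carrier := Subtype.val f

/-- The morphism of graded modules given by a degree preserving linear map. -/
def mkHom {M N : GrMod 𝒜} (f : M.carrier →ₗ[A] N.carrier)
    (hf : ∀ i, ∀ v ∈ M.piece i, f v ∈ N.piece i) : M ⟶ N := (⟨f, hf⟩ : homs M N)

theorem lin_mem {M N : GrMod 𝒜} (f : M ⟶ N) {i : ℤ} {v : M.carrier} (hv : v ∈ M.piece i) :
    lin f v ∈ N.piece i := Subtype.property f i v hv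

theorem hom_ext {M N : GrMod 𝒜} {f g : M ⟶ N} (h : ∀ v, lin f v = lin g v) : f = g :=
  Subtype.ext (LinearMap.ext h)

@[simp] theorem lin_mkHom {M N : GrMod 𝒜} (f : M.carrier →ₗ[A] N.carrier) (hf) :
    lin (mkHom (M := M) (N := N) f hf) = f := rfl

@[simp] theorem lin_id (M : GrMod 𝒜) : lin (𝟙 M) = LinearMap.id := rfl

@[simp] theorem lin_comp {M N P : GrMod 𝒜} (f : M ⟶ N) (g : N ⟶ P) :
    lin (f ≫ g) = lin g ∘ₗ lin f := rfl

instance : Preadditive (GrMod 𝒜) where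
  homGroup M N := inferInstanceAs (AddCommGroup (homs M N))
  add_comp _ _ _ f f' g := hom_ext fun v => map_add (lin g) (lin f v) (lin f' v)
  comp_add _ _ _ _ _ _ := rfl

instance : Linear ℂ (GrMod 𝒜) where
  homModule M N := inferInstanceAs (Module ℂ (homs M N))
  smul_comp _ _ _ c f g := hom_ext fun v =>
    LinearMap.map_smul_of_tower (lin g) c (lin f v)
  comp_smul _ _ _ _ _ _ := rfl

@[simp] theorem lin_zero (M N : GrMod 𝒜) : lin (0 : M ⟶ N) = 0 := rfl

@[simp] theorem lin_add {M N : GrMod 𝒜} (f g : M ⟶ N) : lin (f + g) = lin f + lin g := rfl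

@[simp] theorem lin_smul {M N : GrMod 𝒜} (c : ℂ) (f : M ⟶ N) : lin (c • f) = c • lin f := rfl

theorem lin_proj {M N : GrMod 𝒜} (f : M ⟶ N) (i : ℤ) (v : M.carrier) :
    lin f (proj M.isInternal i v) = proj N.isInternal i (lin f v) := by
  have : v ∈ LinearMap.eqLocus ((lin f).restrictScalars ℂ ∘ₗ proj M.isInternal i)
      (proj N.isInternal i ∘ₗ (lin f).restrictScalars ℂ) := by
    refine mem_of_proj_mem M.isInternal _ v fun j => ?_
    have hj := proj_mem M.isInternal j v
    rw [LinearMap.mem_eqLocus]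
    simp only [LinearMap.comp_apply, LinearMap.restrictScalars_apply]
    by_cases hij : j = i
    · subst hij
      rw [proj_same _ hj, proj_same _ (lin_mem f hj)]
    · rw [proj_ne _ hij hj, proj_ne _ hij (lin_mem f hj), map_zero]
  exact this

/-- A graded submodule, with the induced grading. -/
def sub (M : GrMod 𝒜) (K : Submodule A M.carrier)
    (hK : ∀ i, ∀ v ∈ K, proj M.isInternal i v ∈ K) : GrMod 𝒜 where
  carrier := K
  piece i := (M.piece i).comap (K.subtype.restrictScalars ℂ)
  isInternal := by
    let π : ℤ → K →ₗ[ℂ] K := fun i =>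
      LinearMap.restrict (p := K.restrictScalars ℂ) (q := K.restrictScalars ℂ)
        (proj M.isInternal i) (hK i)
    refine isInternal_of_proj π ?_ ?_ ?_
    · intro i v hv
      exact Subtype.ext (proj_same M.isInternal hv)
    · intro i j v hij hv
      exact Subtype.ext (proj_ne M.isInternal hij hv)
    · rw [eq_top_iff]
      rintro v -
      have : (v : M.carrier) ∈ (⨆ i, (M.piece i).comap (K.subtype.restrictScalars ℂ)).map
          (K.subtype.restrictScalars ℂ) := by
        refine mem_of_proj_mem M.isInternal _ _ fun i => ?_
        exact ⟨⟨_, hK i v v.2⟩, Submodule.mem_iSup_of_mem i (proj_mem M.isInternal i v), rfl⟩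
      obtain ⟨w, hw, hwv⟩ := this
      rwa [← Subtype.ext (show (w : M.carrier) = v from hwv)]
  smul_mem ha hv := M.smul_mem ha hv

/-- The quotient by a graded submodule, with the induced grading. -/
def quot (M : GrMod 𝒜) (K : Submodule A M.carrier)
    (hK : ∀ i, ∀ v ∈ K, proj M.isInternal i v ∈ K) : GrMod 𝒜 where
  carrier := M.carrier ⧸ K
  piece i := (M.piece i).map (K.mkQ.restrictScalars ℂ)
  isInternal := by
    let π : ℤ → (M.carrier ⧸ K) →ₗ[ℂ] (M.carrier ⧸ K) := fun i =>
      Submodule.mapQ (K.restrictScalars ℂ) (K.restrictScalars ℂ) (proj M.isInternal i)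
        (fun v hv => hK i v hv)
    refine isInternal_of_proj π ?_ ?_ ?_
    · rintro i _ ⟨v, hv, rfl⟩
      exact congrArg K.mkQ (proj_same M.isInternal hv)
    · rintro i j _ hij ⟨v, hv, rfl⟩
      exact (congrArg K.mkQ (proj_ne M.isInternal hij hv)).trans (map_zero _)
    · rw [← Submodule.map_iSup, M.isInternal.submodule_iSup_eq_top, Submodule.map_top,
        LinearMap.range_eq_top]
      exact K.mkQ_surjective
  smul_mem := by
    rintro i j a _ ha ⟨v, hv, rfl⟩
    exact ⟨a • v, M.smul_mem ha hv, rfl⟩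

/-- The shifted module `M(s)`, with `M(s)_i = M_{i + s}`. -/
def shift (M : GrMod 𝒜) (s : ℤ) : GrMod 𝒜 where
  carrier := M.carrier
  piece i := M.piece (i + s)
  isInternal := by
    refine isInternal_of_proj (fun i => proj M.isInternal (i + s)) ?_ ?_ ?_
    · intro i v hv
      exact proj_same M.isInternal hv
    · intro i j v hij hv
      exact proj_ne M.isInternal (by omega) hv
    · rw [← M.isInternal.submodule_iSup_eq_top]
      exact (Equiv.addRight s).iSup_comp
  smul_mem ha hv := by
    rw [add_assoc]
    exact M.smul_mem ha hv

/-- The direct sum of two graded modules. -/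
def prod (M N : GrMod 𝒜) : GrMod 𝒜 where
  carrier := M.carrier × N.carrier
  piece i := (M.piece i).prod (N.piece i)
  isInternal := by
    refine isInternal_of_proj
      (fun i => (proj M.isInternal i).prodMap (proj N.isInternal i)) ?_ ?_ ?_
    · rintro i v ⟨h1, h2⟩
      exact Prod.ext (proj_same _ h1) (proj_same _ h2)
    · rintro i j v hij ⟨h1, h2⟩
      exact Prod.ext (proj_ne _ hij h1) (proj_ne _ hij h2)
    · rw [eq_top_iff]
      rintro ⟨v, w⟩ -
      have h1 : v ∈ (⨆ i, (M.piece i).prod (N.piece i)).comap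
          (LinearMap.inl ℂ M.carrier N.carrier) :=
        mem_of_proj_mem M.isInternal _ v fun i =>
          Submodule.mem_iSup_of_mem i ⟨proj_mem _ i v, (N.piece i).zero_mem⟩
      have h2 : w ∈ (⨆ i, (M.piece i).prod (N.piece i)).comap
          (LinearMap.inr ℂ M.carrier N.carrier) :=
        mem_of_proj_mem N.isInternal _ w fun i =>
          Submodule.mem_iSup_of_mem i ⟨(M.piece i).zero_mem, proj_mem _ i w⟩
      simpa using Submodule.add_mem _ (Submodule.mem_comap.1 h1) (Submodule.mem_comap.1 h2)
  smul_mem ha hv := ⟨M.smul_mem ha hv.1, N.smul_mem ha hv.2⟩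

/-- The zero module. -/
def zero (𝒜 : ℤ → Submodule ℂ A) : GrMod 𝒜 where
  carrier := PUnit
  piece _ := ⊤
  isInternal := isInternal_of_proj (fun _ => 0) (fun _ _ _ => rfl) (fun _ _ _ _ _ => rfl)
    (Subsingleton.elim _ _)
  smul_mem _ _ := trivial

instance : HasZeroObject (GrMod 𝒜) :=
  ⟨zero 𝒜, (IsZero.iff_id_eq_zero _).2 (hom_ext fun _ => rfl)⟩

instance : HasBinaryBiproducts (GrMod 𝒜) where
  has_binary_biproduct M N := hasBinaryBiproduct_of_total
    { pt := prod M N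
      fst := mkHom (M := prod M N) (LinearMap.fst A M.carrier N.carrier) fun _ _ hv => hv.1
      snd := mkHom (M := prod M N) (LinearMap.snd A M.carrier N.carrier) fun _ _ hv => hv.2
      inl := mkHom (N := prod M N) (LinearMap.inl A M.carrier N.carrier)
        fun i _ hv => ⟨hv, (N.piece i).zero_mem⟩
      inr := mkHom (N := prod M N) (LinearMap.inr A M.carrier N.carrier)
        fun i _ hv => ⟨(M.piece i).zero_mem, hv⟩
      inl_fst := rfl
      inl_snd := rfl
      inr_fst := rfl
      inr_snd := rfl }
    (hom_ext fun v => Prod.ext (add_zero v.1) (zero_add v.2))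

instance : HasFiniteProducts (GrMod 𝒜) := hasFiniteProducts_of_has_binary_and_terminal

section Abelian

variable {M N : GrMod 𝒜} (f : M ⟶ N)

theorem ker_stable (i : ℤ) (v : M.carrier) (hv : v ∈ LinearMap.ker (lin f)) :
    proj M.isInternal i v ∈ LinearMap.ker (lin f) := by
  rw [LinearMap.mem_ker] at hv ⊢
  rw [lin_proj, hv, map_zero]

theorem range_stable (i : ℤ) (v : N.carrier) (hv : v ∈ LinearMap.range (lin f)) :
    proj N.isInternal i v ∈ LinearMap.range (lin f) := by
  obtain ⟨w, rfl⟩ := hv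
  exact ⟨_, lin_proj f i w⟩

/-- The inclusion of a graded submodule. -/
def subι (M : GrMod 𝒜) (K : Submodule A M.carrier) (hK) : sub M K hK ⟶ M :=
  mkHom (M := sub M K hK) K.subtype fun _ _ hv => hv

/-- The projection to a graded quotient module. -/
def quotπ (M : GrMod 𝒜) (K : Submodule A M.carrier) (hK) : M ⟶ quot M K hK :=
  mkHom (N := quot M K hK) K.mkQ fun _ v hv => ⟨v, hv, rfl⟩

/-- A morphism that vanishes on a graded submodule factors through the quotient. -/
def quotDesc (M : GrMod 𝒜) (K : Submodule A M.carrier) (hK) {P : GrMod 𝒜} (g : M ⟶ P)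
    (hg : K ≤ LinearMap.ker (lin g)) : quot M K hK ⟶ P :=
  mkHom (M := quot M K hK) (K.liftQ (lin g) hg) (by
    rintro i _ ⟨v, hv, rfl⟩
    exact lin_mem g hv)

theorem quot_hom_ext (M : GrMod 𝒜) (K : Submodule A M.carrier) (hK) {P : GrMod 𝒜}
    {g h : quot M K hK ⟶ P} (e : quotπ M K hK ≫ g = quotπ M K hK ≫ h) : g = h := by
  refine hom_ext fun v => ?_
  obtain ⟨v, rfl⟩ := K.mkQ_surjective v
  exact LinearMap.congr_fun (congrArg lin e) v

/-- Kernel, cokernel and image factorisation of a morphism of graded modules. -/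
def abelianStruct : Abelian.AbelianStruct f where
  kernelFork := KernelFork.ofι (subι M _ (ker_stable f)) (hom_ext fun v => v.2)
  isLimitKernelFork := KernelFork.IsLimit.ofι _ _
    (fun {W} g hg => mkHom (N := sub M _ (ker_stable f))
      (LinearMap.codRestrict _ (lin g) fun v => LinearMap.congr_fun (congrArg lin hg) v)
      fun _ _ hv => lin_mem g hv)
    (fun _ _ => rfl)
    (fun g hg b hb => hom_ext fun v => Subtype.ext (LinearMap.congr_fun (congrArg lin hb) v))
  cokernelCofork := CokernelCofork.ofπ (quotπ N _ (range_stable f))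
    (hom_ext fun v => (Submodule.Quotient.mk_eq_zero _).2 ⟨v, rfl⟩)
  isColimitCokernelCofork := CokernelCofork.IsColimit.ofπ _ _
    (fun g hg => quotDesc N _ _ g (by
      rintro _ ⟨v, rfl⟩
      exact LinearMap.congr_fun (congrArg lin hg) v))
    (fun _ _ => rfl)
    (fun _ _ _ hb => quot_hom_ext _ _ _ hb)
  image := quot M _ (ker_stable f)
  imageπ := quotπ M _ (ker_stable f)
  ι_imageπ := hom_ext fun v => (Submodule.Quotient.mk_eq_zero _).2 v.2
  imageIsCokernel := CokernelCofork.IsColimit.ofπ _ _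
    (fun g hg => quotDesc M _ _ g (fun v hv => LinearMap.congr_fun (congrArg lin hg) ⟨v, hv⟩))
    (fun _ _ => rfl)
    (fun _ _ _ hb => quot_hom_ext _ _ _ hb)
  imageι := quotDesc M _ _ f le_rfl
  imageι_π := quot_hom_ext _ _ _
    (hom_ext fun v => (Submodule.Quotient.mk_eq_zero _).2 ⟨v, rfl⟩)
  imageIsKernel := by
    have inj : Function.Injective ((LinearMap.ker (lin f)).liftQ (lin f) le_rfl) := by
      rw [← LinearMap.ker_eq_bot]
      exact Submodule.ker_liftQ_eq_bot _ _ _ le_rfl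
    have hr : ∀ {W : GrMod 𝒜} (g : W ⟶ N), g ≫ quotπ N _ (range_stable f) = 0 →
        ∀ v, lin g v ∈ LinearMap.range (lin f) := fun g hg v =>
      (Submodule.Quotient.mk_eq_zero _).1 (LinearMap.congr_fun (congrArg lin hg) v)
    have hfac : ∀ w : LinearMap.range (lin f), (LinearMap.ker (lin f)).liftQ (lin f) le_rfl
        ((lin f).quotKerEquivRange.symm w) = w := fun w =>
      congrArg Subtype.val ((lin f).quotKerEquivRange.apply_symm_apply w)
    refine KernelFork.IsLimit.ofι _ _
      (fun {W} g hg => mkHom (N := quot M _ (ker_stable f))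
        ((lin f).quotKerEquivRange.symm.toLinearMap ∘ₗ
          LinearMap.codRestrict (LinearMap.range (lin f)) (lin g) (hr g hg)) ?_) ?_ ?_
    · intro i v hv
      obtain ⟨w, hw⟩ := hr g hg v
      refine ⟨proj M.isInternal i w, proj_mem _ i w, inj ?_⟩
      refine Eq.trans ?_ (hfac ⟨lin g v, hr g hg v⟩).symm
      change lin f (proj M.isInternal i w) = lin g v
      rw [lin_proj, hw, proj_same _ (lin_mem g hv)]
    · intro W g hg
      exact hom_ext fun v => hfac ⟨lin g v, hr g hg v⟩
    · intro W g hg b hb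
      refine hom_ext fun v => inj ?_
      refine Eq.trans ?_ (hfac ⟨lin g v, hr g hg v⟩).symm
      exact LinearMap.congr_fun (congrArg lin hb) v
  fac := rfl

end Abelian

instance : Abelian (GrMod 𝒜) := Abelian.mk' fun _ _ f => ⟨abelianStruct f⟩

instance : HasExt.{1} (GrMod 𝒜) := HasExt.standard _

end GrMod

/-! ### The graded ring `ℂ[x, y] / (x ^ k)` -/

/-- The ideal `(x ^ k)` of `ℂ[x, y]`, where `x = X 0` and `y = X 1`. -/
def relIdeal (k : ℕ) : Ideal (MvPolynomial (Fin 2) ℂ) := Ideal.span {MvPolynomial.X 0 ^ k}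

/-- The ring `R_k = ℂ[x, y] / (x ^ k)`. -/
abbrev R (k : ℕ) : Type := MvPolynomial (Fin 2) ℂ ⧸ relIdeal k

/-- The class of `x`. -/
def x (k : ℕ) : R k := Ideal.Quotient.mk (relIdeal k) (MvPolynomial.X 0)

/-- The class of `y`. -/
def y (k : ℕ) : R k := Ideal.Quotient.mk (relIdeal k) (MvPolynomial.X 1)

/-- The grading of `ℂ[x, y]` with `x` in degree `1` and `y` in degree `-1`. -/
def polyPiece (n : ℤ) : Submodule ℂ (MvPolynomial (Fin 2) ℂ) :=
  MvPolynomial.weightedHomogeneousSubmodule ℂ (![1, -1] : Fin 2 → ℤ) n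

/-- The induced grading of `R_k`. -/
def ringPiece (k : ℕ) (n : ℤ) : Submodule ℂ (R k) :=
  (polyPiece n).map (Ideal.Quotient.mkₐ ℂ (relIdeal k)).toLinearMap

instance : GradedAlgebra polyPiece :=
  MvPolynomial.weightedGradedAlgebra ℂ (![1, -1] : Fin 2 → ℤ)

/-- In a graded algebra, an ideal generated by homogeneous elements is graded. -/
theorem proj_mem_span {B : Type} [CommRing B] [Algebra ℂ B] (ℬ : ℤ → Submodule ℂ B)
    [SetLike.GradedMonoid ℬ] (h : DirectSum.IsInternal ℬ) (s : Set B)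
    (hs : ∀ b ∈ s, ∃ i, b ∈ ℬ i) (i : ℤ) (v : B) (hv : v ∈ Ideal.span s) :
    proj h i v ∈ Ideal.span s := by
  let : DirectSum.Decomposition ℬ := h.chooseDecomposition
  let : GradedRing ℬ := {}
  have hom : (Ideal.span s).IsHomogeneous ℬ := Ideal.homogeneous_span ℬ s hs
  have e : DirectSum.decompose ℬ v =
      (LinearEquiv.ofBijective (DirectSum.coeLinearMap ℬ) h).symm v := by
    apply h.1
    refine ((DirectSum.decompose ℬ).symm_apply_apply v).trans ?_
    exact ((LinearEquiv.ofBijective (DirectSum.coeLinearMap ℬ) h).apply_symm_apply v).symm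
  have hi := hom i hv
  rw [e] at hi
  exact hi

theorem polyPiece_isInternal : DirectSum.IsInternal polyPiece :=
  DirectSum.Decomposition.isInternal _

/-- The graded ring `ℂ[x, y]` as a graded module over itself. -/
def polyModule : GrMod polyPiece where
  carrier := MvPolynomial (Fin 2) ℂ
  piece := polyPiece
  isInternal := polyPiece_isInternal
  smul_mem ha hv := SetLike.GradedMul.mul_mem ha hv

theorem relIdeal_stable (k : ℕ) (i : ℤ) (v : MvPolynomial (Fin 2) ℂ) (hv : v ∈ relIdeal k) :
    proj polyPiece_isInternal i v ∈ relIdeal k := by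
  refine proj_mem_span polyPiece _ _ ?_ i v hv
  rintro _ rfl
  exact ⟨_, (MvPolynomial.isWeightedHomogeneous_X ℂ ![1, -1] 0).pow k⟩

theorem ringPiece_isInternal (k : ℕ) : DirectSum.IsInternal (ringPiece k) :=
  (GrMod.quot polyModule (relIdeal k) (relIdeal_stable k)).isInternal

instance (k : ℕ) : SetLike.GradedMonoid (ringPiece k) where
  one_mem := ⟨1, SetLike.GradedOne.one_mem, rfl⟩
  mul_mem := by
    rintro i j _ _ ⟨a, ha, rfl⟩ ⟨b, hb, rfl⟩
    exact ⟨a * b, SetLike.GradedMul.mul_mem ha hb, rfl⟩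

/-- The graded module `R_k` over itself. -/
def ringModule (k : ℕ) : GrMod (ringPiece k) where
  carrier := R k
  piece := ringPiece k
  isInternal := ringPiece_isInternal k
  smul_mem ha hv := SetLike.GradedMul.mul_mem ha hv

theorem x_mem (k : ℕ) : x k ∈ ringPiece k 1 :=
  ⟨_, MvPolynomial.isWeightedHomogeneous_X ℂ ![1, -1] 0, rfl⟩

theorem y_mem (k : ℕ) : y k ∈ ringPiece k (-1) :=
  ⟨_, MvPolynomial.isWeightedHomogeneous_X ℂ ![1, -1] 1, rfl⟩

/-! ### The graded module attached to a `k`-subset of the integers -/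

section Subsets

variable {k : ℕ} (hk : 2 ≤ k) (ℓ : Finset ℤ) (hℓ : ℓ.card = k)

/-- The largest element `ℓ_k` of the `k`-subset `ℓ = {ℓ_1 < ⋯ < ℓ_k}`. -/
def top : ℤ := ℓ.orderEmbOfFin hℓ ⟨k - 1, by omega⟩

/-- The ideal of `R_k` generated by the monomials `x ^ (p - 1) * y ^ (ℓ_k - ℓ_p - (k - p))` for
`1 ≤ p ≤ k`.  The index `q : Fin k` stands for `p = q + 1`, and the exponents of `y` are
nonnegative because `ℓ_1 < ⋯ < ℓ_k`. -/
def subsetIdeal : Ideal (R k) :=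
  Ideal.span (Set.range fun q : Fin k =>
    x k ^ (q : ℕ) * y k ^ (top hk ℓ hℓ - ℓ.orderEmbOfFin hℓ q - (k - 1 - (q : ℤ))).toNat)

theorem subsetIdeal_stable (i : ℤ) (v : R k) (hv : v ∈ subsetIdeal hk ℓ hℓ) :
    proj (ringPiece_isInternal k) i v ∈ subsetIdeal hk ℓ hℓ := by
  refine proj_mem_span (ringPiece k) _ _ ?_ i v hv
  rintro _ ⟨q, rfl⟩
  exact ⟨_, SetLike.GradedMul.mul_mem (SetLike.pow_mem_graded _ (x_mem k))
    (SetLike.pow_mem_graded _ (y_mem k))⟩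

/-- The graded module `I(ℓ)`: the graded ideal above, shifted by `k - 1 - ℓ_k`.  In it the
generator with index `p` has degree `ℓ_p`. -/
def subsetModule : GrMod (ringPiece k) :=
  (GrMod.sub (ringModule k) (subsetIdeal hk ℓ hℓ) (subsetIdeal_stable hk ℓ hℓ)).shift
    (k - 1 - top hk ℓ hℓ)

end Subsets

/-- The complex vector space `Ext¹(M, N)` of graded `R_k`-modules, whose elements are the
classes of extensions `0 → N → E → M → 0` with degree preserving maps. -/
abbrev Ext1 {k : ℕ} (M N : GrMod (ringPiece k)) : Type 1 := Abelian.Ext M N 1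

end GrassmannInfinite

end

/-!
`Ext¹(I(ℓ), I(m))` is computed from the start of a free resolution, and its dimension comes out as
an expression symmetric in `ℓ` and `m`.

Write `ℓ_0 < ⋯ < ℓ_{k-1}` for the elements of `ℓ`. The module `I(ℓ)` has generators `e_p` of degree
`ℓ_p`, with relations `x e_p = y ^ b_p e_{p+1}` of degree `ℓ_p + 1`, where
`b_p = ℓ_{p+1} - ℓ_p - 1` and `e_k = 0` (`ker_coverMap`). So `Ext¹(I(ℓ), N)` is the space of
morphisms from the kernel of the free cover to `N`, modulo those that extend to the cover
(`GrMod.exists_surjective_ext`).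

Setting `x = t` and `y = 1` gives a ring map `R_k → ℂ[t] / (t ^ k)` that is injective on every
homogeneous component, and that sends the component of degree `i` of `I(m)` onto `(t ^ a)`, where
`a` is the number of elements of `m` below `i` (`spec_injective_of_mem`, `mem_powIdeal_iff_exists`).
Morphisms to `I(m)` thereby become vectors over `ℂ[t] / (t ^ k)`. Those defined on the cover are the
vectors `(v_p)` with `v_p ∈ I(m)_{ℓ_p}` (`range_evalCover`). Those defined on its kernel are the
vectors `(w_p)` with `w_p ∈ I(m)_{ℓ_p + 1}` and `∑ t ^ (k - 1 - p) w_p = 0`, because this is the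
only syzygy among the relations after inverting `y` (`range_evalSyzygy`). Restriction is
`w_p = t v_p - v_{p+1}`.

Its kernel is `(t ^ h)`, where `h` is the largest excess `#{m < i} - #{ℓ < i}` over all `i`. The
image of the linear form is `(t ^ (k - h'))`, where `h'` is the largest excess with `ℓ` and `m`
exchanged (`excess_swap`). Passing from degree `ℓ_p` to `ℓ_p + 1` lowers the total dimension by
`#(ℓ ∩ m)`. Hence `dim Ext¹(I(ℓ), I(m)) = k - h - h' - #(ℓ ∩ m)` (`finrank_ext_formula`).
-/

open CategoryTheory CategoryTheory.Limits

noncomputable section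

namespace GrassmannInfinite

/-! ### Truncated polynomial rings -/

/-- The truncated polynomial ring `ℂ[t] / (t ^ k)`. -/
abbrev Trunc (k : ℕ) : Type := Polynomial ℂ ⧸ Ideal.span {(Polynomial.X : Polynomial ℂ) ^ k}

/-- The class of the variable in `ℂ[t] / (t ^ k)`. -/
def tvar (k : ℕ) : Trunc k := Ideal.Quotient.mk _ Polynomial.X

namespace Trunc

variable {k : ℕ}

theorem tvar_pow_self : tvar k ^ k = 0 := by
  rw [tvar, ← map_pow, Ideal.Quotient.eq_zero_iff_mem]
  exact Ideal.mem_span_singleton_self _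

theorem tvar_pow_eq_zero {n : ℕ} (h : k ≤ n) : tvar k ^ n = 0 :=
  pow_eq_zero_of_le h tvar_pow_self

/-- The ideal `(t ^ a)` of `ℂ[t] / (t ^ k)`, as a complex subspace. -/
def powIdeal (k a : ℕ) : Submodule ℂ (Trunc k) :=
  (Ideal.span {tvar k ^ a}).restrictScalars ℂ

theorem mem_powIdeal {a : ℕ} {v : Trunc k} : v ∈ powIdeal k a ↔ tvar k ^ a ∣ v :=
  Ideal.mem_span_singleton

theorem mk_mem_powIdeal {a : ℕ} (ha : a ≤ k) (P : Polynomial ℂ) :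
    (Ideal.Quotient.mk _ P : Trunc k) ∈ powIdeal k a ↔ Polynomial.X ^ a ∣ P := by
  rw [mem_powIdeal, tvar, ← map_pow]
  constructor
  · rintro ⟨u, hu⟩
    obtain ⟨U, rfl⟩ := Ideal.Quotient.mk_surjective u
    rw [← map_mul, Ideal.Quotient.mk_eq_mk_iff_sub_mem, Ideal.mem_span_singleton] at hu
    exact (dvd_sub_left (dvd_mul_right _ _)).1 ((pow_dvd_pow _ ha).trans hu)
  · exact fun h => map_dvd _ h

theorem powIdeal_zero : powIdeal k 0 = ⊤ :=
  eq_top_iff.2 fun v _ => mem_powIdeal.2 (by simp)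

theorem powIdeal_antitone : Antitone (powIdeal k) := fun _ _ h _ hv =>
  mem_powIdeal.2 ((pow_dvd_pow _ h).trans (mem_powIdeal.1 hv))

theorem powIdeal_self : powIdeal k k = ⊥ :=
  eq_bot_iff.2 fun v hv => by
    rw [mem_powIdeal, tvar_pow_self, zero_dvd_iff] at hv
    exact hv

theorem tvar_pow_mem (a : ℕ) : tvar k ^ a ∈ powIdeal k a := mem_powIdeal.2 dvd_rfl

theorem tvar_pow_mul_mem {a b : ℕ} {v : Trunc k} (hv : v ∈ powIdeal k a) :
    tvar k ^ b * v ∈ powIdeal k (b + a) := by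
  rw [mem_powIdeal] at hv ⊢
  rw [pow_add]
  exact mul_dvd_mul_left _ hv

/-- Multiplication by `t ^ b` reflects membership in `(t ^ a)` up to the expected shift; the
truncated subtraction covers `a ≤ b`, where both sides hold for all `v`. -/
theorem tvar_pow_mul_mem_iff {a b : ℕ} (ha : a ≤ k) (v : Trunc k) :
    tvar k ^ b * v ∈ powIdeal k a ↔ v ∈ powIdeal k (a - b) := by
  obtain ⟨P, rfl⟩ := Ideal.Quotient.mk_surjective v
  rcases le_total a b with h | h
  · rw [Nat.sub_eq_zero_of_le h, powIdeal_zero]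
    exact iff_of_true (powIdeal_antitone h (mem_powIdeal.2 (dvd_mul_right _ _))) trivial
  · rw [mk_mem_powIdeal (by omega), tvar, ← map_pow, ← map_mul, mk_mem_powIdeal ha]
    obtain ⟨c, rfl⟩ := Nat.exists_eq_add_of_le h
    rw [Nat.add_sub_cancel_left, pow_add,
      mul_dvd_mul_iff_left (pow_ne_zero _ Polynomial.X_ne_zero)]

theorem mk_eq_sum (P : Polynomial ℂ) :
    (Ideal.Quotient.mk _ P : Trunc k) = ∑ p : Fin k, P.coeff p • tvar k ^ (p : ℕ) := by
  have : (∑ p : Fin k, P.coeff p • tvar k ^ (p : ℕ) : Trunc k) =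
      Ideal.Quotient.mk _ (∑ p : Fin k, P.coeff p • Polynomial.X ^ (p : ℕ)) := by
    rw [map_sum]
    rfl
  rw [this, Ideal.Quotient.mk_eq_mk_iff_sub_mem, Ideal.mem_span_singleton,
    Polynomial.X_pow_dvd_iff]
  intro d hd
  rw [Polynomial.coeff_sub, Polynomial.finsetSum_coeff, Finset.sum_eq_single ⟨d, hd⟩]
  · simp
  · intro b _ hb
    have : d ≠ b := fun h => hb (Fin.ext h.symm)
    simp [Polynomial.coeff_X_pow, this]
  · simp

theorem linearIndependent_tvar_pow :
    LinearIndependent ℂ (fun p : Fin k => tvar k ^ (p : ℕ)) := by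
  rw [Fintype.linearIndependent_iff]
  intro g hg i
  have : (∑ p : Fin k, g p • tvar k ^ (p : ℕ) : Trunc k) =
      Ideal.Quotient.mk _ (∑ p : Fin k, g p • Polynomial.X ^ (p : ℕ)) := by
    rw [map_sum]
    rfl
  rw [this, Ideal.Quotient.eq_zero_iff_mem, Ideal.mem_span_singleton,
    Polynomial.X_pow_dvd_iff] at hg
  have h := hg i i.2
  rw [Polynomial.finsetSum_coeff, Finset.sum_eq_single i] at h
  · simpa using h
  · intro b _ hb
    have : (i : ℕ) ≠ b := fun h => hb (Fin.ext h.symm)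
    simp [Polynomial.coeff_X_pow, this]
  · simp

theorem powIdeal_eq_span {a : ℕ} (ha : a ≤ k) : powIdeal k a =
    Submodule.span ℂ (Set.range fun p : {p : Fin k // a ≤ p} => tvar k ^ ((p : Fin k) : ℕ)) := by
  apply le_antisymm
  · intro v hv
    obtain ⟨P, rfl⟩ := Ideal.Quotient.mk_surjective v
    rw [mk_mem_powIdeal ha, Polynomial.X_pow_dvd_iff] at hv
    rw [mk_eq_sum]
    refine Submodule.sum_mem _ fun p _ => ?_
    by_cases hp : a ≤ p
    · exact Submodule.smul_mem _ _ (Submodule.subset_span ⟨⟨p, hp⟩, rfl⟩)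
    · rw [hv p (by omega), zero_smul]
      exact Submodule.zero_mem _
  · rw [Submodule.span_le]
    rintro _ ⟨p, rfl⟩
    exact powIdeal_antitone p.2 (tvar_pow_mem _)

instance : Module.Finite ℂ (Trunc k) := by
  classical
  refine ⟨⟨Finset.univ.image fun p : Fin k => tvar k ^ (p : ℕ), ?_⟩⟩
  rw [eq_top_iff, Finset.coe_image, Finset.coe_univ, Set.image_univ]
  rintro v -
  obtain ⟨P, rfl⟩ := Ideal.Quotient.mk_surjective v
  rw [mk_eq_sum]
  exact Submodule.sum_mem _ fun p _ =>
    Submodule.smul_mem _ _ (Submodule.subset_span ⟨p, rfl⟩)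

theorem finrank_powIdeal {a : ℕ} (ha : a ≤ k) : Module.finrank ℂ (powIdeal k a) = k - a := by
  rw [powIdeal_eq_span ha]
  refine (finrank_span_eq_card
    (linearIndependent_tvar_pow.comp _ Subtype.val_injective)).trans ?_
  rw [Fintype.card_subtype]
  have := Finset.card_filter_add_card_filter_not (s := (Finset.univ : Finset (Fin k)))
    (fun p : Fin k => (p : ℕ) < a)
  simp only [not_lt, Finset.card_univ, Fintype.card_fin, Fin.card_filter_val_lt] at this
  omega

end Trunc

/-! ### Specialisation at `y = 1` -/

/-- The algebra map `R_k → ℂ[t] / (t ^ k)` with `x ↦ t` and `y ↦ 1`.  It identifies the degree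
zero part of `R_k[y⁻¹]` with `ℂ[t] / (t ^ k)`. -/
def spec (k : ℕ) : R k →ₐ[ℂ] Trunc k :=
  Ideal.Quotient.liftₐ (relIdeal k) (MvPolynomial.aeval ![tvar k, 1]) (by
    intro a ha
    rw [← RingHom.mem_ker]
    refine (Ideal.span_singleton_le_iff_mem _).2 ?_ ha
    rw [RingHom.mem_ker]
    simp [Trunc.tvar_pow_self])

@[simp] theorem spec_x (k : ℕ) : spec k (x k) = tvar k := by
  exact (Ideal.Quotient.lift_mk _ _ _).trans (by simp)

@[simp] theorem spec_y (k : ℕ) : spec k (y k) = 1 := by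
  exact (Ideal.Quotient.lift_mk _ _ _).trans (by simp)

theorem x_pow_self (k : ℕ) : x k ^ k = 0 := by
  rw [x, ← map_pow, Ideal.Quotient.eq_zero_iff_mem]
  exact Ideal.mem_span_singleton_self _

theorem monomial_mem (k a b : ℕ) : x k ^ a * y k ^ b ∈ ringPiece k ((a : ℤ) - b) := by
  have := SetLike.GradedMul.mul_mem (SetLike.pow_mem_graded a (x_mem k))
    (SetLike.pow_mem_graded b (y_mem k))
  convert this using 1
  simp [sub_eq_add_neg]

theorem ringPiece_le_span (k : ℕ) (n : ℤ) : ringPiece k n ≤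
    Submodule.span ℂ {v | ∃ a b : ℕ, (a : ℤ) - b = n ∧ v = x k ^ a * y k ^ b} := by
  rintro _ ⟨f, hf, rfl⟩
  rw [f.as_sum, map_sum]
  refine Submodule.sum_mem _ fun d hd => ?_
  have hw := hf (MvPolynomial.mem_support_iff.1 hd)
  have : (MvPolynomial.monomial d (f.coeff d)) =
      f.coeff d • (MvPolynomial.X 0 ^ d 0 * MvPolynomial.X 1 ^ d 1) := by
    rw [MvPolynomial.monomial_eq, MvPolynomial.smul_eq_C_mul, Finsupp.prod_fintype _ _ (by simp)]
    simp
  rw [this, map_smul]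
  refine Submodule.smul_mem _ _ (Submodule.subset_span ⟨d 0, d 1, ?_, ?_⟩)
  · rw [← hw]
    simp [Finsupp.weight_apply, Finsupp.sum_fintype, sub_eq_add_neg]
  · simp [x, y]

/-- A homogeneous element of `R_k` is a combination of monomials, and these have distinct images
under specialisation. -/
theorem spec_injective_of_mem {n : ℤ} {v : R k} (hv : v ∈ ringPiece k n) (h : spec k v = 0) :
    v = 0 := by
  let M : Fin k → R k := fun p => if n ≤ p then x k ^ (p : ℕ) * y k ^ ((p : ℤ) - n).toNat else 0
  have hs : v ∈ Submodule.span ℂ (Set.range M) := by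
    refine Submodule.span_le.2 ?_ (ringPiece_le_span k n hv)
    rintro _ ⟨a, b, hab, rfl⟩
    by_cases ha : a < k
    · refine Submodule.subset_span ⟨⟨a, ha⟩, ?_⟩
      have h1 : n ≤ a := by omega
      have h2 : ((a : ℤ) - n).toNat = b := by omega
      simp [M, h1, h2]
    · rw [pow_eq_zero_of_le (not_lt.1 ha) (x_pow_self k), zero_mul]
      exact Submodule.zero_mem _
  obtain ⟨c, rfl⟩ := (Submodule.mem_span_range_iff_exists_fun ℂ).1 hs
  have hc := Fintype.linearIndependent_iff.1 (Trunc.linearIndependent_tvar_pow (k := k))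
    (fun p => if n ≤ p then c p else 0) (by
      rw [← h, map_sum]
      refine Finset.sum_congr rfl fun p _ => ?_
      by_cases hp : n ≤ p <;> simp [M, hp])
  refine Finset.sum_eq_zero fun p _ => ?_
  have := hc p
  by_cases hp : n ≤ p <;> simp_all [M]

/-! ### Graded modules: lifting and graded free modules -/

namespace GrMod

variable {A : Type} [CommRing A] [Algebra ℂ A] {𝒜 : ℤ → Submodule ℂ A}

theorem surjective_of_epi {M N : GrMod 𝒜} (f : M ⟶ N) [Epi f] :
    Function.Surjective (lin f) := by
  have h : quotπ N _ (range_stable f) = 0 := by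
    rw [← cancel_epi f, comp_zero]
    exact hom_ext fun v => (Submodule.Quotient.mk_eq_zero _).2 ⟨v, rfl⟩
  intro v
  exact (Submodule.Quotient.mk_eq_zero _).1 (LinearMap.congr_fun (congrArg lin h) v)

theorem epi_of_surjective {M N : GrMod 𝒜} (f : M ⟶ N) (hf : Function.Surjective (lin f)) :
    Epi f where
  left_cancellation g h e := hom_ext fun v => by
    obtain ⟨w, rfl⟩ := hf v
    exact LinearMap.congr_fun (congrArg lin e) w

/-- Homogeneous elements lift to homogeneous elements of the same degree. -/
theorem exists_lift_mem {M N : GrMod 𝒜} (f : M ⟶ N) (hf : Function.Surjective (lin f)) {i : ℤ}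
    {v : N.carrier} (hv : v ∈ N.piece i) : ∃ w ∈ M.piece i, lin f w = v := by
  obtain ⟨w, rfl⟩ := hf v
  exact ⟨proj M.isInternal i w, proj_mem _ _ _, by rw [lin_proj, proj_same _ hv]⟩

/-- To show that an element of a graded submodule lies in another submodule, it suffices to treat
homogeneous elements. -/
theorem le_of_homogeneous (M : GrMod 𝒜) (K L : Submodule A M.carrier)
    (hK : ∀ i, ∀ v ∈ K, proj M.isInternal i v ∈ K)
    (h : ∀ i, ∀ v ∈ K, v ∈ M.piece i → v ∈ L) : K ≤ L := fun v hv =>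
  mem_of_proj_mem M.isInternal (L.restrictScalars ℂ) v fun i =>
    h i _ (hK i v hv) (proj_mem _ _ _)

/-- A morphism factors through a surjective one if it vanishes on its kernel. -/
theorem exists_comp_eq {M N P : GrMod 𝒜} (φ : M ⟶ N) (hφ : Function.Surjective (lin φ))
    (f : M ⟶ P) (hf : LinearMap.ker (lin φ) ≤ LinearMap.ker (lin f)) :
    ∃ g : N ⟶ P, φ ≫ g = f := by
  let e := (lin φ).quotKerEquivOfSurjective hφ
  have key : ∀ w, (Submodule.liftQ _ (lin f) hf) (e.symm (lin φ w)) = lin f w := by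
    intro w
    have : e.symm (lin φ w) = Submodule.Quotient.mk w := by
      rw [LinearEquiv.symm_apply_eq]
      rfl
    rw [this]
    rfl
  refine ⟨mkHom ((Submodule.liftQ _ (lin f) hf) ∘ₗ e.symm.toLinearMap) ?_, hom_ext key⟩
  intro i v hv
  obtain ⟨w, hw, rfl⟩ := exists_lift_mem φ hφ hv
  have := lin_mem f hw
  rw [← key w] at this
  exact this

section Free

variable [SetLike.GradedMonoid 𝒜] (h𝒜 : DirectSum.IsInternal 𝒜) {ι : Type} [Fintype ι]
  [DecidableEq ι] (d : ι → ℤ)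

/-- The graded free module with one basis vector of degree `d p` for each `p`. -/
def free : GrMod 𝒜 where
  carrier := ι → A
  piece i := Submodule.pi Set.univ fun p => 𝒜 (i - d p)
  isInternal := by
    refine isInternal_of_proj
      (fun i => LinearMap.pi fun p => proj h𝒜 (i - d p) ∘ₗ LinearMap.proj p) ?_ ?_ ?_
    · intro i v hv
      exact funext fun p => proj_same h𝒜 (hv p trivial)
    · intro i j v hij hv
      exact funext fun p => proj_ne h𝒜 (by omega) (hv p trivial)
    · rw [eq_top_iff]
      rintro v -
      rw [← Finset.univ_sum_single v]
      refine Submodule.sum_mem _ fun p _ => ?_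
      have h1 : v p ∈ (⨆ i, Submodule.pi Set.univ fun q => 𝒜 (i - d q)).comap
          (LinearMap.single ℂ (fun _ => A) p) := by
        refine mem_of_proj_mem h𝒜 _ _ fun i => ?_
        refine Submodule.mem_iSup_of_mem (i + d p) fun q _ => ?_
        by_cases hq : q = p
        · subst hq
          simpa using proj_mem h𝒜 i (v q)
        · simp [hq]
      exact h1
  smul_mem {i j a v} ha hv p _ := by
    have := SetLike.GradedMul.mul_mem ha (hv p trivial)
    rwa [← add_sub_assoc] at this

variable {d}

/-- The coordinates of an element of the graded free module. -/
def coord (p : ι) : (free h𝒜 d).carrier →ₗ[A] A :=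
  (LinearMap.proj p : (ι → A) →ₗ[A] A)

theorem mem_free_piece {i : ℤ} {v : (free h𝒜 d).carrier} :
    v ∈ (free h𝒜 d).piece i ↔ ∀ p, coord h𝒜 p v ∈ 𝒜 (i - d p) :=
  ⟨fun h p => h p trivial, fun h p _ => h p⟩

theorem coord_ext {v w : (free h𝒜 d).carrier} (h : ∀ p, coord h𝒜 p v = coord h𝒜 p w) : v = w :=
  funext h

/-- The element of the graded free module with given coordinates. -/
def ofCoord (d : ι → ℤ) (c : ι → A) : (free h𝒜 d).carrier := c

@[simp] theorem coord_ofCoord (c : ι → A) (p : ι) : coord h𝒜 p (ofCoord h𝒜 d c) = c p := rfl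

/-- A basis vector of the graded free module. -/
def basisVec (d : ι → ℤ) (p : ι) : (free h𝒜 d).carrier := ofCoord h𝒜 d (Pi.single p 1)

theorem coord_basisVec (p q : ι) : coord h𝒜 q (basisVec h𝒜 d p) = if q = p then 1 else 0 := by
  rw [basisVec, coord_ofCoord, Pi.single_apply]

theorem basisVec_mem (p : ι) : basisVec h𝒜 d p ∈ (free h𝒜 d).piece (d p) := by
  rw [mem_free_piece]
  intro q
  rw [coord_basisVec]
  split_ifs with hq
  · rw [hq, sub_self]
    exact SetLike.GradedOne.one_mem
  · exact Submodule.zero_mem _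

theorem free_eq_sum (v : (free h𝒜 d).carrier) :
    v = ∑ p, coord h𝒜 p v • basisVec h𝒜 d p := by
  refine coord_ext h𝒜 fun q => ?_
  simp [coord_basisVec]

theorem lin_free {M : GrMod 𝒜} (f : free h𝒜 d ⟶ M) (v : (free h𝒜 d).carrier) :
    lin f v = ∑ p, coord h𝒜 p v • lin f (basisVec h𝒜 d p) := by
  conv_lhs => rw [free_eq_sum h𝒜 v]
  simp

/-- The morphism from a graded free module with prescribed values on the basis. -/
def freeDesc {M : GrMod 𝒜} (u : ι → M.carrier) (hu : ∀ p, u p ∈ M.piece (d p)) :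
    free h𝒜 d ⟶ M :=
  mkHom (∑ p, (coord h𝒜 p).smulRight (u p)) fun i v hv => by
    rw [LinearMap.sum_apply]
    refine Submodule.sum_mem _ fun p _ => ?_
    have := M.smul_mem ((mem_free_piece h𝒜).1 hv p) (hu p)
    rwa [sub_add_cancel] at this

theorem lin_freeDesc {M : GrMod 𝒜} (u : ι → M.carrier) (hu : ∀ p, u p ∈ M.piece (d p))
    (v : (free h𝒜 d).carrier) : lin (freeDesc h𝒜 u hu) v = ∑ p, coord h𝒜 p v • u p := by
  simp [freeDesc]

theorem lin_freeDesc_basisVec {M : GrMod 𝒜} (u : ι → M.carrier)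
    (hu : ∀ p, u p ∈ M.piece (d p)) (p : ι) :
    lin (freeDesc h𝒜 u hu) (basisVec h𝒜 d p) = u p := by
  simp [lin_freeDesc, coord_basisVec]

theorem free_hom_ext {M : GrMod 𝒜} {f g : free h𝒜 d ⟶ M}
    (h : ∀ p, lin f (basisVec h𝒜 d p) = lin g (basisVec h𝒜 d p)) : f = g :=
  hom_ext fun v => by
    rw [lin_free, lin_free h𝒜 g]
    simp only [h]

instance : Projective (free h𝒜 d) where
  factors {M N} f e _ := by
    choose u hu hu' using fun p =>
      exists_lift_mem e (surjective_of_epi e) (lin_mem f (basisVec_mem h𝒜 (d := d) p))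
    refine ⟨freeDesc h𝒜 u hu, free_hom_ext h𝒜 fun p => ?_⟩
    rw [lin_comp, LinearMap.comp_apply, lin_freeDesc_basisVec, hu']

end Free

/-! ### First extension groups from a projective presentation -/

section Ext

variable {P M : GrMod 𝒜} (π : P ⟶ M)

/-- The kernel of a morphism of graded modules. -/
def syzygy : GrMod 𝒜 := sub P (LinearMap.ker (lin π)) (ker_stable π)

/-- The inclusion of the kernel. -/
def syzygyι : syzygy π ⟶ P := subι P (LinearMap.ker (lin π)) (ker_stable π)

theorem syzygyι_comp : syzygyι π ≫ π = 0 := hom_ext fun v => v.2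

theorem syzygy_shortExact (hπ : Function.Surjective (lin π)) :
    (ShortComplex.mk (syzygyι π) π (syzygyι_comp π)).ShortExact := by
  have := epi_of_surjective π hπ
  have hm : Mono (syzygyι π) :=
    ⟨fun g h e => hom_ext fun v => Subtype.ext (LinearMap.congr_fun (congrArg lin e) v)⟩
  exact
    { exact := ShortComplex.exact_of_f_is_kernel _ (abelianStruct π).isLimitKernelFork
      mono_f := hm
      epi_g := this }

/-- Restriction of morphisms `P ⟶ N` to the kernel of `π`. -/
def restrictSyzygy (N : GrMod 𝒜) : (P ⟶ N) →ₗ[ℂ] (syzygy π ⟶ N) :=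
  Linear.leftComp ℂ N (syzygyι π)

/-- If `P` is projective, `Ext¹(M, N)` is the space of morphisms from the kernel of `P ⟶ M` to `N`
modulo those that extend to `P`. -/
theorem exists_surjective_ext [Projective P] (hπ : Function.Surjective (lin π)) (N : GrMod 𝒜) :
    ∃ δ : (syzygy π ⟶ N) →ₗ[ℂ] Abelian.Ext M N 1, Function.Surjective δ ∧
      LinearMap.ker δ = LinearMap.range (restrictSyzygy π N) := by
  have hS := syzygy_shortExact π hπ
  refine ⟨(Abelian.Ext.precompOfLinear hS.extClass ℂ N (add_zero 1)) ∘ₗ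
    (Abelian.Ext.linearEquiv₀ (R := ℂ)).symm.toLinearMap, ?_, ?_⟩
  · intro e
    obtain ⟨x₁, hx₁⟩ := Abelian.Ext.contravariant_sequence_exact₃ hS N e
      (Abelian.Ext.eq_zero_of_projective _) (add_zero 1)
    exact ⟨Abelian.Ext.linearEquiv₀ (R := ℂ) x₁, by simpa using hx₁⟩
  · ext f
    constructor
    · intro hf
      obtain ⟨x₂, hx₂⟩ := Abelian.Ext.contravariant_sequence_exact₁ hS N (Abelian.Ext.mk₀ f)
        (add_zero 1) (by simpa using hf)
      obtain ⟨g, rfl⟩ := (Abelian.Ext.mk₀_bijective _ _).2 x₂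
      refine ⟨g, ?_⟩
      rw [Abelian.Ext.mk₀_comp_mk₀] at hx₂
      exact (Abelian.Ext.mk₀_bijective _ _).1 hx₂
    · rintro ⟨g, rfl⟩
      have : hS.extClass.comp (Abelian.Ext.mk₀ (syzygyι π ≫ g)) (add_zero 1) = 0 := by
        rw [← Abelian.Ext.mk₀_comp_mk₀,
          ← Abelian.Ext.comp_assoc _ _ _ (add_zero 1) (add_zero 0) (by simp),
          hS.extClass_comp, Abelian.Ext.zero_comp]
      simpa [restrictSyzygy] using this

end Ext

end GrMod

open GrMod

/-! ### Counting in strictly increasing sequences -/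

section Sequences

variable {k : ℕ} {L : Fin k → ℤ}

theorem sub_le_sub_of_strictMono (hL : StrictMono L) {p q : Fin k} (h : p ≤ q) :
    (q : ℤ) - p ≤ L q - L p := by
  have key : ∀ d : ℕ, ∀ q : Fin k, (q : ℕ) = p + d → (d : ℤ) ≤ L q - L p := by
    intro d
    induction d with
    | zero =>
      intro q hq
      rw [show q = p from Fin.ext hq]
      simp
    | succ d ih =>
      intro q hq
      have h1 := ih ⟨p + d, by omega⟩ rfl
      have h2 : L ⟨p + d, by omega⟩ < L q := hL (Fin.lt_def.2 (by simp only; omega))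
      push_cast
      omega
  have h1 : (p : ℕ) ≤ q := h
  have := key ((q : ℕ) - p) q (by omega)
  omega

/-- The number of entries of the sequence `L` that are smaller than `i`. -/
def below (L : Fin k → ℤ) (i : ℤ) : ℕ := (Finset.univ.filter fun p => L p < i).card

theorem below_le (L : Fin k → ℤ) (i : ℤ) : below L i ≤ k :=
  (Finset.card_le_univ _).trans_eq (Fintype.card_fin k)

theorem below_le_iff (hL : StrictMono L) (i : ℤ) (p : Fin k) : below L i ≤ p ↔ i ≤ L p := by
  constructor
  · intro h
    by_contra! hlt
    have hsub : Finset.Iic p ⊆ Finset.univ.filter fun q => L q < i := fun q hq =>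
      Finset.mem_filter.2
        ⟨Finset.mem_univ _, (hL.monotone (Finset.mem_Iic.1 hq)).trans_lt hlt⟩
    have := Finset.card_le_card hsub
    rw [Fin.card_Iic] at this
    rw [below] at h
    omega
  · intro h
    have hsub : (Finset.univ.filter fun q => L q < i) ⊆ Finset.Iio p := fun q hq =>
      Finset.mem_Iio.2 (hL.lt_iff_lt.1 ((Finset.mem_filter.1 hq).2.trans_le h))
    have := Finset.card_le_card hsub
    rwa [Fin.card_Iio] at this

end Sequences

/-! ### The free cover and its relations -/

section Cover

variable {k : ℕ} (L : Fin k → ℤ)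

/-- The graded free `R_k`-module with basis vectors of degrees `L p`. -/
abbrev cover : GrMod (ringPiece k) := free (ringPiece_isInternal k) L

/-- The basis vectors of the free cover. -/
abbrev coverVec (p : Fin k) : (cover L).carrier := basisVec (ringPiece_isInternal k) L p

/-- The coefficients of the relations `x e_p = y ^ (L (p + 1) - L p - 1) e_{p + 1}`, where
`e_k = 0`. -/
def relCoeff (p q : Fin k) : R k :=
  if q = p then x k else if (q : ℕ) = p + 1 then -y k ^ (L q - L p - 1).toNat else 0

/-- The relations as elements of the free cover. -/
def relVec (p : Fin k) : (cover L).carrier := ofCoord (ringPiece_isInternal k) L (relCoeff L p)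

/-- The matrix of relations after the specialisation `y = 1`: it has `t` on the diagonal and `-1`
directly above it. -/
def relMatrix (k : ℕ) : Matrix (Fin k) (Fin k) (Trunc k) := fun p q =>
  if q = p then tvar k else if (q : ℕ) = p + 1 then -1 else 0

theorem spec_relCoeff (p q : Fin k) : spec k (relCoeff L p q) = relMatrix k p q := by
  unfold relCoeff relMatrix
  split_ifs <;> simp

theorem relVec_mem (hL : StrictMono L) (p : Fin k) :
    relVec L p ∈ (cover L).piece (L p + 1) := by
  rw [mem_free_piece]
  intro q
  rw [relVec, coord_ofCoord, relCoeff]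
  split_ifs with h1 h2
  · rw [h1, add_sub_cancel_left]
    exact x_mem k
  · have := sub_le_sub_of_strictMono hL (show p ≤ q from Fin.le_def.2 (by omega))
    have h := monomial_mem k 0 (L q - L p - 1).toNat
    rw [pow_zero, one_mul] at h
    have e : L p + 1 - L q = ((0 : ℕ) : ℤ) - ((L q - L p - 1).toNat : ℕ) := by omega
    rw [e]
    exact Submodule.neg_mem _ h
  · exact Submodule.zero_mem _

theorem x_smul_coverVec (p : Fin k) : x k • coverVec L p = relVec L p +
    if h : (p : ℕ) + 1 < k then
      y k ^ (L ⟨p + 1, h⟩ - L p - 1).toNat • coverVec L ⟨p + 1, h⟩ else 0 := by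
  refine coord_ext _ fun q => ?_
  split_ifs with h
  · rw [map_smul, coord_basisVec, map_add, relVec, coord_ofCoord, map_smul, coord_basisVec,
      relCoeff]
    by_cases h1 : q = p
    · have : q ≠ ⟨p + 1, h⟩ := fun e => by
        have := congrArg Fin.val e
        have := congrArg Fin.val h1
        simp only at *
        omega
      simp [h1, Fin.ext_iff]
    · by_cases h2 : (q : ℕ) = p + 1
      · have : q = ⟨p + 1, h⟩ := Fin.ext h2
        subst this
        simp [h1]
      · have : q ≠ ⟨p + 1, h⟩ := fun e => h2 (congrArg Fin.val e)
        simp [h1, h2, this]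
  · rw [map_smul, coord_basisVec, add_zero, relVec, coord_ofCoord, relCoeff]
    have : (q : ℕ) ≠ p + 1 := by omega
    simp [this]

/-- The vector `y ^ (L p - i) e_p` of degree `i`, or zero if there is none. -/
def pureVec (i : ℤ) (p : Fin k) : (cover L).carrier :=
  if i ≤ L p then y k ^ (L p - i).toNat • coverVec L p else 0

variable {L}

theorem monomial_smul_coverVec_mem (hL : StrictMono L) (i : ℤ) (a : ℕ) : ∀ (b : ℕ) (p : Fin k),
    (a : ℤ) - b + L p = i → (x k ^ a * y k ^ b) • coverVec L p ∈
      (Submodule.span (R k) (Set.range (relVec L))).restrictScalars ℂ ⊔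
        Submodule.span ℂ (Set.range (pureVec L i)) := by
  induction a with
  | zero =>
    intro b p h
    refine Submodule.mem_sup_right (Submodule.subset_span ⟨p, ?_⟩)
    have h1 : i ≤ L p := by omega
    have h2 : (L p - i).toNat = b := by omega
    rw [pureVec, if_pos h1, h2, pow_zero, one_mul]
  | succ a ih =>
    intro b p h
    rw [show x k ^ (a + 1) * y k ^ b = (x k ^ a * y k ^ b) * x k by ring, mul_smul,
      x_smul_coverVec, smul_add]
    refine Submodule.add_mem _ (Submodule.mem_sup_left
      (Submodule.smul_mem _ _ (Submodule.subset_span (Set.mem_range_self p)))) ?_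
    split_ifs with hp
    · rw [← mul_smul, mul_assoc, ← pow_add]
      apply ih
      have : L p < L ⟨p + 1, hp⟩ := hL (Fin.lt_def.2 (by simp))
      push_cast at h ⊢
      omega
    · rw [smul_zero]
      exact Submodule.zero_mem _

/-- Modulo the relations, every vector of degree `i` is a complex combination of the vectors
`y ^ (L p - i) e_p`. -/
theorem exists_sub_mem_span_relVec (hL : StrictMono L) {i : ℤ} {v : (cover L).carrier}
    (hv : v ∈ (cover L).piece i) : ∃ c : Fin k → ℂ,
      v - ∑ p, c p • pureVec L i p ∈ Submodule.span (R k) (Set.range (relVec L)) := by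
  have h : v ∈ (Submodule.span (R k) (Set.range (relVec L))).restrictScalars ℂ ⊔
        Submodule.span ℂ (Set.range (pureVec L i)) := by
    rw [free_eq_sum _ v]
    refine Submodule.sum_mem _ fun p _ => ?_
    have hle := (ringPiece_le_span k _) ((mem_free_piece _).1 hv p)
    let f : R k →ₗ[ℂ] (cover L).carrier :=
      (LinearMap.toSpanSingleton (R k) _ (coverVec L p)).restrictScalars ℂ
    suffices hs : coord _ p v ∈ Submodule.comap f (_ ⊔ _) from hs
    refine Submodule.span_le.2 ?_ hle
    rintro _ ⟨a, b, hab, rfl⟩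
    exact monomial_smul_coverVec_mem hL i a b p (by omega)
  obtain ⟨u, hu, w, hw, rfl⟩ := Submodule.mem_sup.1 h
  obtain ⟨c, rfl⟩ := (Submodule.mem_span_range_iff_exists_fun ℂ).1 hw
  exact ⟨c, by rwa [add_sub_cancel_right]⟩

end Cover

/-! ### The presentation of the module of a subset -/

section Presentation

variable {k : ℕ} (hk : 2 ≤ k) (ℓ : Finset ℤ) (hℓ : ℓ.card = k)

/-- The elements of a `k`-subset of the integers, in increasing order. -/
abbrev enum : Fin k → ℤ := ℓ.orderEmbOfFin hℓ

theorem enum_strictMono : StrictMono (enum ℓ hℓ) := (ℓ.orderEmbOfFin hℓ).strictMono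

/-- The inclusion of the ideal underlying `I(ℓ)` into `R_k`; it does not respect degrees. -/
def toRing : (subsetModule hk ℓ hℓ).carrier →ₗ[R k] R k :=
  (subsetIdeal hk ℓ hℓ).subtype

theorem mem_subsetModule_piece {i : ℤ} {v : (subsetModule hk ℓ hℓ).carrier} :
    v ∈ (subsetModule hk ℓ hℓ).piece i ↔
      toRing hk ℓ hℓ v ∈ ringPiece k (i + (k - 1 - top hk ℓ hℓ)) := Iff.rfl

theorem toRing_injective : Function.Injective (toRing hk ℓ hℓ) := Subtype.val_injective

/-- The specialisation `y = 1` on `I(ℓ)`. -/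
def specMod : (subsetModule hk ℓ hℓ).carrier →ₗ[ℂ] Trunc k :=
  (spec k).toLinearMap ∘ₗ (toRing hk ℓ hℓ).restrictScalars ℂ

theorem specMod_smul (r : R k) (v : (subsetModule hk ℓ hℓ).carrier) :
    specMod hk ℓ hℓ (r • v) = spec k r * specMod hk ℓ hℓ v := by
  simp [specMod]

theorem specMod_injective_of_mem {i : ℤ} {v : (subsetModule hk ℓ hℓ).carrier}
    (hv : v ∈ (subsetModule hk ℓ hℓ).piece i) (h : specMod hk ℓ hℓ v = 0) : v = 0 :=
  toRing_injective hk ℓ hℓ ((spec_injective_of_mem hv h).trans (map_zero _).symm)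

/-- The monomial generators of `I(ℓ)`. -/
def gen (p : Fin k) : (subsetModule hk ℓ hℓ).carrier :=
  (⟨_, Ideal.subset_span ⟨p, rfl⟩⟩ : subsetIdeal hk ℓ hℓ)

theorem toRing_gen (p : Fin k) : toRing hk ℓ hℓ (gen hk ℓ hℓ p) =
    x k ^ (p : ℕ) * y k ^ (top hk ℓ hℓ - enum ℓ hℓ p - (k - 1 - (p : ℤ))).toNat := rfl

theorem gen_mem (p : Fin k) :
    gen hk ℓ hℓ p ∈ (subsetModule hk ℓ hℓ).piece (enum ℓ hℓ p) := by
  rw [mem_subsetModule_piece, toRing_gen]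
  have h := sub_le_sub_of_strictMono (enum_strictMono ℓ hℓ)
    (show p ≤ ⟨k - 1, by omega⟩ from Fin.le_def.2 (by simp only; omega))
  change _ ≤ top hk ℓ hℓ - _ at h
  simp only at h
  have e : enum ℓ hℓ p + (k - 1 - top hk ℓ hℓ) = ((p : ℕ) : ℤ) -
      ((top hk ℓ hℓ - enum ℓ hℓ p - (k - 1 - (p : ℤ))).toNat : ℕ) := by omega
  rw [e]
  exact monomial_mem k _ _

theorem specMod_gen (p : Fin k) : specMod hk ℓ hℓ (gen hk ℓ hℓ p) = tvar k ^ (p : ℕ) := by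
  simp [specMod, toRing_gen]

/-- The surjection from the free cover to `I(ℓ)`. -/
def coverMap : cover (enum ℓ hℓ) ⟶ subsetModule hk ℓ hℓ :=
  freeDesc _ (gen hk ℓ hℓ) (gen_mem hk ℓ hℓ)

theorem coverMap_surjective : Function.Surjective (lin (coverMap hk ℓ hℓ)) := by
  intro v
  have hv : toRing hk ℓ hℓ v ∈ subsetIdeal hk ℓ hℓ := Subtype.property v
  obtain ⟨c, hc⟩ := (Submodule.mem_span_range_iff_exists_fun (R k)).1 hv
  refine ⟨ofCoord _ _ c, toRing_injective hk ℓ hℓ ?_⟩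
  rw [coverMap, lin_freeDesc, ← hc, map_sum]
  exact Finset.sum_congr rfl fun p _ => map_smul _ _ _

theorem specMod_coverMap (v : (cover (enum ℓ hℓ)).carrier) :
    specMod hk ℓ hℓ (lin (coverMap hk ℓ hℓ) v) =
      ∑ p, spec k (coord _ p v) * tvar k ^ (p : ℕ) := by
  rw [coverMap, lin_freeDesc, map_sum]
  simp only [specMod_smul, specMod_gen]

theorem specMod_coverMap_pureVec (i : ℤ) (p : Fin k) :
    specMod hk ℓ hℓ (lin (coverMap hk ℓ hℓ) (pureVec _ i p)) =
      if i ≤ enum ℓ hℓ p then tvar k ^ (p : ℕ) else 0 := by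
  rw [pureVec]
  split_ifs
  · rw [map_smul, coverMap, lin_freeDesc_basisVec, specMod_smul, specMod_gen]
    simp
  · simp

theorem sum_relMatrix_mul (v : Fin k → Trunc k) (p : Fin k) :
    ∑ q, relMatrix k p q * v q =
      tvar k * v p - if h : (p : ℕ) + 1 < k then v ⟨p + 1, h⟩ else 0 := by
  split_ifs with h
  · have hne : p ≠ ⟨p + 1, h⟩ := fun e => by simpa using congrArg Fin.val e
    rw [Finset.sum_eq_add p ⟨p + 1, h⟩ hne]
    · simp only [relMatrix, Fin.ext_iff]
      simp
      ring
    · rintro q - ⟨h1, h2⟩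
      have : (q : ℕ) ≠ p + 1 := fun e => h2 (Fin.ext e)
      simp [relMatrix, h1, this]
    · simp
    · simp
  · rw [Finset.sum_eq_single p]
    · simp [relMatrix]
    · intro q _ h1
      have : (q : ℕ) ≠ p + 1 := by omega
      simp [relMatrix, h1, this]
    · simp

theorem sum_relMatrix_mul_tvar_pow (p : Fin k) :
    ∑ q : Fin k, relMatrix k p q * tvar k ^ (q : ℕ) = 0 := by
  rw [sum_relMatrix_mul fun q : Fin k => tvar k ^ (q : ℕ), ← pow_succ']
  split_ifs with h
  · exact sub_self _
  · rw [Trunc.tvar_pow_eq_zero (by omega), sub_zero]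

theorem coverMap_relVec (p : Fin k) : lin (coverMap hk ℓ hℓ) (relVec _ p) = 0 := by
  refine specMod_injective_of_mem hk ℓ hℓ
    (lin_mem _ (relVec_mem _ (enum_strictMono ℓ hℓ) p)) ?_
  rw [specMod_coverMap]
  simp only [relVec, coord_ofCoord, spec_relCoeff]
  exact sum_relMatrix_mul_tvar_pow p

theorem ker_coverMap : LinearMap.ker (lin (coverMap hk ℓ hℓ)) =
    Submodule.span (R k) (Set.range (relVec (enum ℓ hℓ))) := by
  have hle : Submodule.span (R k) (Set.range (relVec (enum ℓ hℓ))) ≤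
      LinearMap.ker (lin (coverMap hk ℓ hℓ)) := by
    rw [Submodule.span_le]
    rintro _ ⟨p, rfl⟩
    exact coverMap_relVec hk ℓ hℓ p
  refine le_antisymm ?_ hle
  refine le_of_homogeneous _ _ _ (ker_stable _) fun i v hv hvi => ?_
  obtain ⟨c, hc⟩ := exists_sub_mem_span_relVec (enum_strictMono ℓ hℓ) hvi
  have h0 : lin (coverMap hk ℓ hℓ) (∑ p, c p • pureVec _ i p) = 0 := by
    have := LinearMap.mem_ker.1 (hle hc)
    rwa [map_sub, LinearMap.mem_ker.1 hv, zero_sub, neg_eq_zero] at this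
  have h1 := congrArg (specMod hk ℓ hℓ) h0
  simp only [map_sum, map_zero, LinearMap.map_smul_of_tower, specMod_coverMap_pureVec] at h1
  have h2 := Fintype.linearIndependent_iff.1 (Trunc.linearIndependent_tvar_pow (k := k))
    (fun p => if i ≤ enum ℓ hℓ p then c p else 0) (by
      rw [← h1]
      refine Finset.sum_congr rfl fun p _ => ?_
      split_ifs <;> simp)
  have h3 : ∑ p, c p • pureVec (enum ℓ hℓ) i p = 0 := by
    refine Finset.sum_eq_zero fun p _ => ?_
    have := h2 p
    rw [pureVec]
    split_ifs at this ⊢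
    · rw [this, zero_smul]
    · rw [smul_zero]
  rwa [h3, sub_zero] at hc

/-- The specialisation `y = 1` identifies the component of degree `i` of `I(ℓ)` with the ideal
`(t ^ a)`, where `a` is the number of elements of `ℓ` below `i`. -/
theorem mem_powIdeal_iff_exists (i : ℤ) (w : Trunc k) :
    w ∈ Trunc.powIdeal k (below (enum ℓ hℓ) i) ↔
      ∃ v ∈ (subsetModule hk ℓ hℓ).piece i, specMod hk ℓ hℓ v = w := by
  constructor
  · intro hw
    rw [Trunc.powIdeal_eq_span (below_le _ _)] at hw
    refine (Submodule.span_le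
      (p := ((subsetModule hk ℓ hℓ).piece i).map (specMod hk ℓ hℓ))).2 ?_ hw
    rintro _ ⟨⟨p, hp⟩, rfl⟩
    have hp' := (below_le_iff (enum_strictMono ℓ hℓ) i p).1 hp
    refine ⟨y k ^ (enum ℓ hℓ p - i).toNat • gen hk ℓ hℓ p, ?_, ?_⟩
    · have h := monomial_mem k 0 (enum ℓ hℓ p - i).toNat
      rw [pow_zero, one_mul] at h
      have := (subsetModule hk ℓ hℓ).smul_mem h (gen_mem hk ℓ hℓ p)
      have e : ((0 : ℕ) : ℤ) - ((enum ℓ hℓ p - i).toNat : ℕ) + enum ℓ hℓ p = i := by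
        have := Int.toNat_of_nonneg (sub_nonneg.2 hp')
        rw [this]
        simp
      rwa [e] at this
    · simp [specMod_smul, specMod_gen]
  · rintro ⟨v, hv, rfl⟩
    obtain ⟨u, hu, rfl⟩ := exists_lift_mem _ (coverMap_surjective hk ℓ hℓ) hv
    obtain ⟨c, hc⟩ := exists_sub_mem_span_relVec (enum_strictMono ℓ hℓ) hu
    rw [← ker_coverMap hk, LinearMap.mem_ker, map_sub, sub_eq_zero] at hc
    rw [hc, map_sum, map_sum]
    refine Submodule.sum_mem _ fun p _ => ?_
    rw [LinearMap.map_smul_of_tower, map_smul, specMod_coverMap_pureVec]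
    refine Submodule.smul_mem _ _ ?_
    split_ifs with h
    · exact Trunc.powIdeal_antitone ((below_le_iff (enum_strictMono ℓ hℓ) i p).2 h)
        (Trunc.tvar_pow_mem _)
    · exact Submodule.zero_mem _

end Presentation

/-! ### The matrix of relations over the truncated polynomial ring -/

section RelMatrix

variable {k : ℕ}

theorem sum_mul_relMatrix_succ (u : Fin k → Trunc k) (p : Fin k) (h : (p : ℕ) + 1 < k) :
    ∑ q, u q * relMatrix k q ⟨p + 1, h⟩ = u ⟨p + 1, h⟩ * tvar k - u p := by
  have hne : ⟨p + 1, h⟩ ≠ p := fun e => by simpa using congrArg Fin.val e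
  rw [Finset.sum_eq_add ⟨p + 1, h⟩ p hne]
  · simp only [relMatrix, Fin.ext_iff]
    simp
    ring
  · rintro q - ⟨h1, h2⟩
    have h3 : p ≠ q := Ne.symm h2
    have h4 : (p : ℕ) ≠ q := fun e => h3 (Fin.ext e)
    simp [relMatrix, Ne.symm h1, h4]
  · simp
  · simp

theorem sum_mul_relMatrix_zero (u : Fin k → Trunc k) (h : 0 < k) :
    ∑ q, u q * relMatrix k q ⟨0, h⟩ = u ⟨0, h⟩ * tvar k := by
  rw [Finset.sum_eq_single ⟨0, h⟩]
  · simp [relMatrix]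
  · intro q _ h1
    simp [relMatrix, Ne.symm h1]
  · simp

theorem sum_tvar_pow_mul_relMatrix (q : Fin k) :
    ∑ p : Fin k, tvar k ^ (k - 1 - (p : ℕ)) * relMatrix k p q = 0 := by
  obtain ⟨q, hq⟩ := q
  cases q with
  | zero =>
    rw [sum_mul_relMatrix_zero (fun p : Fin k => tvar k ^ (k - 1 - (p : ℕ))), ← pow_succ]
    exact Trunc.tvar_pow_eq_zero (by simp only; omega)
  | succ q =>
    rw [sum_mul_relMatrix_succ (fun p : Fin k => tvar k ^ (k - 1 - (p : ℕ))) ⟨q, by omega⟩ hq,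
      ← pow_succ, sub_eq_zero]
    congr 1
    simp only
    omega

/-- A row vector annihilated by the matrix of relations is determined by its last entry. -/
theorem eq_tvar_pow_mul_last {u : Fin k → Trunc k} (hu : ∀ q, ∑ p, u p * relMatrix k p q = 0)
    (p : Fin k) : u p = tvar k ^ (k - 1 - (p : ℕ)) * u ⟨k - 1, by have := p.2; omega⟩ := by
  have key : ∀ d : ℕ, ∀ p : Fin k, (p : ℕ) + d = k - 1 →
      u p = tvar k ^ d * u ⟨k - 1, by have := p.2; omega⟩ := by
    intro d
    induction d with
    | zero =>
      intro p hp
      rw [pow_zero, one_mul]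
      exact congrArg u (Fin.ext hp)
    | succ d ih =>
      intro p hp
      have h1 := hu ⟨p + 1, by omega⟩
      rw [sum_mul_relMatrix_succ u p, sub_eq_zero] at h1
      rw [← h1, ih ⟨p + 1, by omega⟩ (by simp only; omega)]
      ring
  exact key _ p (by omega)

/-- A column vector annihilated by the matrix of relations is determined by its first entry. -/
theorem eq_tvar_pow_mul_first {v : Fin k → Trunc k} (hv : ∀ p, ∑ q, relMatrix k p q * v q = 0)
    (p : Fin k) : v p = tvar k ^ (p : ℕ) * v ⟨0, p.pos⟩ := by
  obtain ⟨p, hp⟩ := p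
  induction p with
  | zero => simp
  | succ p ih =>
    have h1 := hv ⟨p, by omega⟩
    rw [sum_relMatrix_mul, dif_pos hp, sub_eq_zero] at h1
    rw [← h1, ih (by omega)]
    simp only
    ring

end RelMatrix

/-! ### Morphisms from the cover and from its kernel -/

section Homs

variable {k : ℕ} (hk : 2 ≤ k) (ℓ m : Finset ℤ) (hℓ : ℓ.card = k) (hm : m.card = k)

/-- The specialised values at the basis vectors of a morphism from the cover of `I(ℓ)` to `I(m)`. -/
def evalCover : (cover (enum ℓ hℓ) ⟶ subsetModule hk m hm) →ₗ[ℂ] (Fin k → Trunc k) where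
  toFun f p := specMod hk m hm (lin f (coverVec _ p))
  map_add' f g := by
    ext p
    simp
  map_smul' c f := by
    ext p
    simp

theorem range_evalCover : LinearMap.range (evalCover hk ℓ m hℓ hm) =
    Submodule.pi Set.univ fun p => Trunc.powIdeal k (below (enum m hm) (enum ℓ hℓ p)) := by
  ext w
  constructor
  · rintro ⟨f, rfl⟩ p -
    exact (mem_powIdeal_iff_exists hk m hm _ _).2
      ⟨_, lin_mem f (basisVec_mem _ p), rfl⟩
  · intro hw
    choose u hu hu' using fun p => (mem_powIdeal_iff_exists hk m hm _ _).1 (hw p trivial)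
    refine ⟨freeDesc _ u hu, funext fun p => ?_⟩
    rw [← hu']
    exact congrArg (specMod hk m hm) (lin_freeDesc_basisVec _ u hu p)

/-- The relations as elements of the kernel of the cover. -/
def relElt (p : Fin k) : (syzygy (coverMap hk ℓ hℓ)).carrier :=
  (⟨relVec _ p, coverMap_relVec hk ℓ hℓ p⟩ : LinearMap.ker (lin (coverMap hk ℓ hℓ)))

theorem syzygyι_relElt (p : Fin k) :
    lin (syzygyι (coverMap hk ℓ hℓ)) (relElt hk ℓ hℓ p) = relVec _ p := rfl

theorem syzygyι_injective : Function.Injective (lin (syzygyι (coverMap hk ℓ hℓ))) :=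
  Subtype.val_injective

theorem relElt_mem (p : Fin k) :
    relElt hk ℓ hℓ p ∈ (syzygy (coverMap hk ℓ hℓ)).piece (enum ℓ hℓ p + 1) :=
  relVec_mem _ (enum_strictMono ℓ hℓ) p

/-- The second free cover, which maps its basis vectors to the relations. -/
def relMap : cover (fun p => enum ℓ hℓ p + 1) ⟶ syzygy (coverMap hk ℓ hℓ) :=
  freeDesc _ (relElt hk ℓ hℓ) (relElt_mem hk ℓ hℓ)

theorem relMap_surjective : Function.Surjective (lin (relMap hk ℓ hℓ)) := by
  intro v
  have hv : lin (syzygyι (coverMap hk ℓ hℓ)) v ∈ LinearMap.ker (lin (coverMap hk ℓ hℓ)) :=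
    Subtype.property v
  rw [ker_coverMap] at hv
  obtain ⟨c, hc⟩ := (Submodule.mem_span_range_iff_exists_fun (R k)).1 hv
  refine ⟨ofCoord _ _ c, syzygyι_injective hk ℓ hℓ ?_⟩
  rw [relMap, lin_freeDesc, ← hc, map_sum]
  exact Finset.sum_congr rfl fun p _ => map_smul _ _ _

/-- The specialised values at the relations of a morphism from the kernel of the cover of `I(ℓ)`
to `I(m)`. -/
def evalSyzygy : (syzygy (coverMap hk ℓ hℓ) ⟶ subsetModule hk m hm) →ₗ[ℂ] (Fin k → Trunc k) where
  toFun f p := specMod hk m hm (lin f (relElt hk ℓ hℓ p))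
  map_add' f g := by
    ext p
    simp
  map_smul' c f := by
    ext p
    simp

theorem evalSyzygy_injective : Function.Injective (evalSyzygy hk ℓ m hℓ hm) := by
  rw [injective_iff_map_eq_zero]
  intro f hf
  have hz : ∀ p, lin f (relElt hk ℓ hℓ p) = 0 := fun p =>
    specMod_injective_of_mem hk m hm (lin_mem f (relElt_mem hk ℓ hℓ p)) (congrFun hf p)
  refine hom_ext fun v => ?_
  obtain ⟨w, rfl⟩ := relMap_surjective hk ℓ hℓ v
  rw [relMap, lin_freeDesc, map_sum]
  simp [hz]

/-- The matrix of relations as a complex linear map. -/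
def relEnd (k : ℕ) : (Fin k → Trunc k) →ₗ[ℂ] (Fin k → Trunc k) :=
  (relMatrix k).mulVecLin.restrictScalars ℂ

theorem relEnd_apply (k : ℕ) (v : Fin k → Trunc k) (p : Fin k) :
    relEnd k v p = ∑ q, relMatrix k p q * v q := rfl

theorem evalSyzygy_restrict (f : cover (enum ℓ hℓ) ⟶ subsetModule hk m hm) :
    evalSyzygy hk ℓ m hℓ hm (restrictSyzygy (coverMap hk ℓ hℓ) _ f) =
      relEnd k (evalCover hk ℓ m hℓ hm f) := by
  funext p
  change specMod hk m hm (lin f (relVec _ p)) = _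
  rw [lin_free, map_sum, relEnd_apply]
  refine Finset.sum_congr rfl fun q _ => ?_
  rw [specMod_smul, relVec, coord_ofCoord, spec_relCoeff]
  rfl

/-- The linear form `w ↦ ∑ t ^ (k - 1 - p) w_p` that cuts out the values at the relations of
morphisms. -/
def relForm (k : ℕ) : (Fin k → Trunc k) →ₗ[ℂ] Trunc k :=
  (Fintype.linearCombination (Trunc k)
    (fun p : Fin k => tvar k ^ (k - 1 - (p : ℕ)))).restrictScalars ℂ

theorem relForm_apply (k : ℕ) (w : Fin k → Trunc k) :
    relForm k w = ∑ p : Fin k, tvar k ^ (k - 1 - (p : ℕ)) * w p :=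
  (Fintype.linearCombination_apply _ _ _).trans
    (Finset.sum_congr rfl fun _ _ => by rw [smul_eq_mul, mul_comm])

/-- A syzygy among the relations, with coefficients `x ^ (k - 1 - p) y ^ (ℓ_p - ℓ_0 - p)`. It
vanishes because it is homogeneous and its specialisation vanishes. -/
theorem exists_sum_smul_relElt : ∃ r : Fin k → R k,
    (∀ p, spec k (r p) = tvar k ^ (k - 1 - (p : ℕ))) ∧ ∑ p, r p • relElt hk ℓ hℓ p = 0 := by
  have h0 : 0 < k := by omega
  let r : Fin k → R k := fun p => x k ^ (k - 1 - (p : ℕ)) *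
    y k ^ (enum ℓ hℓ p - enum ℓ hℓ ⟨0, h0⟩ - p).toNat
  have hspec : ∀ p, spec k (r p) = tvar k ^ (k - 1 - (p : ℕ)) := fun p => by simp [r]
  refine ⟨r, hspec, syzygyι_injective hk ℓ hℓ ?_⟩
  rw [map_zero, map_sum]
  simp only [map_smul, syzygyι_relElt]
  have hmem : ∑ p, r p • relVec (enum ℓ hℓ) p ∈
      (cover (enum ℓ hℓ)).piece (enum ℓ hℓ ⟨0, h0⟩ + k) := by
    refine Submodule.sum_mem _ fun p _ => ?_
    have h1 := sub_le_sub_of_strictMono (enum_strictMono ℓ hℓ)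
      (show ⟨0, h0⟩ ≤ p from Fin.le_def.2 (Nat.zero_le _))
    have h2 := (cover (enum ℓ hℓ)).smul_mem
      (monomial_mem k (k - 1 - (p : ℕ)) (enum ℓ hℓ p - enum ℓ hℓ ⟨0, h0⟩ - p).toNat)
      (relVec_mem _ (enum_strictMono ℓ hℓ) p)
    have e : ((k - 1 - (p : ℕ) : ℕ) : ℤ) - ((enum ℓ hℓ p - enum ℓ hℓ ⟨0, h0⟩ - p).toNat : ℕ) +
        (enum ℓ hℓ p + 1) = enum ℓ hℓ ⟨0, h0⟩ + k := by
      simp only [Nat.cast_zero, sub_zero] at h1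
      have h3 := Int.toNat_of_nonneg (sub_nonneg.2 h1)
      have h4 : ((k - 1 - (p : ℕ) : ℕ) : ℤ) = k - 1 - p := by omega
      rw [h3, h4]
      ring
    rwa [e] at h2
  refine coord_ext _ fun q => ?_
  rw [map_zero]
  refine spec_injective_of_mem ((mem_free_piece _).1 hmem q) ?_
  rw [map_sum, map_sum]
  refine Eq.trans (Finset.sum_congr rfl fun p _ => ?_) (sum_tvar_pow_mul_relMatrix q)
  rw [map_smul, smul_eq_mul, map_mul, hspec, relVec, coord_ofCoord, spec_relCoeff]

theorem range_evalSyzygy : LinearMap.range (evalSyzygy hk ℓ m hℓ hm) =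
    (Submodule.pi Set.univ fun p =>
      Trunc.powIdeal k (below (enum m hm) (enum ℓ hℓ p + 1))) ⊓ LinearMap.ker (relForm k) := by
  ext w
  constructor
  · rintro ⟨f, rfl⟩
    refine ⟨fun p _ => (mem_powIdeal_iff_exists hk m hm _ _).2
      ⟨_, lin_mem f (relElt_mem hk ℓ hℓ p), rfl⟩, ?_⟩
    obtain ⟨r, hr, h⟩ := exists_sum_smul_relElt hk ℓ hℓ
    have h1 := congrArg (fun v => specMod hk m hm (lin f v)) h
    simp only [map_sum, map_smul, specMod_smul, map_zero, hr] at h1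
    exact (relForm_apply _ _).trans h1
  -- Conversely, the specialised coefficients of any homogeneous syzygy are multiples of
  -- `t ^ (k - 1 - p)`, so a vector in the kernel of the form is compatible with every syzygy.
  · rintro ⟨hw, hw0⟩
    have hw0 := (relForm_apply k w).symm.trans hw0
    choose u hu hu' using fun p => (mem_powIdeal_iff_exists hk m hm _ _).1 (hw p trivial)
    obtain ⟨g, hg⟩ := exists_comp_eq (relMap hk ℓ hℓ) (relMap_surjective hk ℓ hℓ)
      (freeDesc (d := fun p => enum ℓ hℓ p + 1) (ringPiece_isInternal k) u hu) (by
        refine le_of_homogeneous _ _ _ (ker_stable _) fun i v hv hvi => ?_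
        rw [LinearMap.mem_ker] at hv ⊢
        refine specMod_injective_of_mem hk m hm (lin_mem _ hvi) ?_
        have hv' := congrArg (lin (syzygyι (coverMap hk ℓ hℓ))) hv
        rw [relMap, lin_freeDesc, map_zero, map_sum] at hv'
        simp only [map_smul, syzygyι_relElt] at hv'
        have hρ := eq_tvar_pow_mul_last (u := fun p => spec k (coord _ p v)) fun q => by
          have := congrArg (fun z => spec k (coord _ q z)) hv'
          simp only [map_sum, map_smul, map_zero, smul_eq_mul, map_mul, relVec,
            coord_ofCoord, spec_relCoeff] at this
          exact this
        rw [lin_freeDesc, map_sum]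
        simp only [specMod_smul, hu']
        rw [← mul_zero (spec k (coord (ringPiece_isInternal k) ⟨k - 1, by omega⟩ v)), ← hw0,
          Finset.mul_sum]
        refine Finset.sum_congr rfl fun p _ => ?_
        rw [hρ p]
        ring)
    refine ⟨g, funext fun p => ?_⟩
    rw [← hu' p]
    change specMod hk m hm (lin g (relElt hk ℓ hℓ p)) = _
    rw [← lin_freeDesc_basisVec (d := fun p => enum ℓ hℓ p + 1) (ringPiece_isInternal k) u hu p,
      ← hg, lin_comp, LinearMap.comp_apply, relMap, lin_freeDesc_basisVec]

end Homs

/-! ### Dimension counts -/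

section LinearAlgebra

variable {K V W : Type*} [Field K] [AddCommGroup V] [Module K V] [AddCommGroup W] [Module K W]

theorem finrank_map_add_finrank_inf_ker [FiniteDimensional K V] (f : V →ₗ[K] W)
    (E : Submodule K V) : Module.finrank K (E.map f) + Module.finrank K ↥(E ⊓ LinearMap.ker f) =
      Module.finrank K E := by
  rw [← LinearMap.finrank_range_add_finrank_ker (f.domRestrict E), LinearMap.range_domRestrict,
    LinearMap.ker_domRestrict]
  congr 1
  rw [← Submodule.map_comap_subtype]
  exact (Submodule.equivMapOfInjective _ E.injective_subtype _).finrank_eq.symm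

theorem finrank_pi_univ {ι : Type*} [Fintype ι] [FiniteDimensional K V]
    (E : ι → Submodule K V) : Module.finrank K (Submodule.pi Set.univ E) =
      ∑ p, Module.finrank K (E p) := by
  rw [← Module.finrank_pi_fintype]
  exact LinearEquiv.finrank_eq
    { toFun := fun v p => ⟨v.1 p, v.2 p trivial⟩
      invFun := fun v => ⟨fun p => v p, fun p _ => (v p).2⟩
      map_add' := fun _ _ => rfl
      map_smul' := fun _ _ => rfl
      left_inv := fun _ => rfl
      right_inv := fun _ => rfl }

end LinearAlgebra

/-- The largest excess of the number of entries of `M` over that of `L` below an entry of `L`; by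
truncated subtraction it is at least zero. -/
def excess {k : ℕ} (L M : Fin k → ℤ) : ℕ :=
  Finset.univ.sup fun p : Fin k => below M (L p) - p

section Counting

variable {k : ℕ} (L M : Fin k → ℤ)

theorem excess_le : excess L M ≤ k :=
  Finset.sup_le fun _ _ => (Nat.sub_le _ _).trans (below_le M _)

theorem below_add_one (i : ℤ) :
    below M (i + 1) = below M i + ∑ q, if i = M q then 1 else 0 := by
  have h : ∀ q, (if M q < i + 1 then 1 else 0) =
      (if M q < i then 1 else 0) + (if i = M q then 1 else 0) := fun q => by
    split_ifs <;> omega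
  simp only [below, Finset.card_filter, h, Finset.sum_add_distrib]

variable {L M}

/-- The largest excess of `L` over `M`, attained just before an entry of `M`, is also attained
just after an entry of `L`. -/
theorem excess_swap (hL : StrictMono L) (hM : StrictMono M) :
    excess M L = Finset.univ.sup fun p : Fin k => (p + 1 - below M (L p + 1) : ℕ) := by
  apply le_antisymm
  · refine Finset.sup_le fun q _ => ?_
    rcases le_or_gt (below L (M q)) q with h | h
    · rw [Nat.sub_eq_zero_of_le h]
      exact Nat.zero_le _
    · have hk := below_le L (M q)
      let p : Fin k := ⟨below L (M q) - 1, by omega⟩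
      have h1 : L p < M q := by
        by_contra! hc
        have := (below_le_iff hL _ _).2 hc
        simp only [p] at this
        omega
      have h2 := (below_le_iff hM (L p + 1) q).2 h1
      refine le_trans ?_ (Finset.le_sup (Finset.mem_univ p))
      simp only [p] at h2 ⊢
      omega
  · refine Finset.sup_le fun p _ => ?_
    rcases le_or_gt ((p : ℕ) + 1) (below M (L p + 1)) with h | h
    · rw [Nat.sub_eq_zero_of_le h]
      exact Nat.zero_le _
    · have hp := p.2
      let q : Fin k := ⟨below M (L p + 1), by omega⟩
      have h1 : L p + 1 ≤ M q := (below_le_iff hM _ q).1 le_rfl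
      have h2 : ¬ below L (M q) ≤ p := fun hc => by
        have := (below_le_iff hL _ _).1 hc
        omega
      refine le_trans ?_ (Finset.le_sup (Finset.mem_univ q))
      simp only [q] at h2 ⊢
      omega

end Counting

section Dimension

variable {k : ℕ} {L M : Fin k → ℤ}

/-- The kernel of the restriction of morphisms from the cover to the relations, a model of
`Hom(I(ℓ), I(m))`: its elements are the vectors `(t ^ p v)_p`, subject to `v ∈ (t ^ a)` where `a`
is the excess. -/
theorem finrank_pi_inf_ker_relEnd (hk : 0 < k) (L M : Fin k → ℤ) :
    Module.finrank ℂ ↥((Submodule.pi Set.univ fun p => Trunc.powIdeal k (below M (L p))) ⊓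
      LinearMap.ker (relEnd k)) = k - excess L M := by
  let f : Trunc k →ₗ[ℂ] (Fin k → Trunc k) :=
    LinearMap.pi fun p => LinearMap.mulLeft ℂ (tvar k ^ (p : ℕ))
  have hf : Function.Injective f := fun v w h => by
    have := congrFun h ⟨0, hk⟩
    simpa [f] using this
  rw [← Trunc.finrank_powIdeal (excess_le L M),
    (Submodule.equivMapOfInjective f hf (Trunc.powIdeal k (excess L M))).finrank_eq]
  suffices h : (Submodule.pi Set.univ fun p => Trunc.powIdeal k (below M (L p))) ⊓
      LinearMap.ker (relEnd k) = (Trunc.powIdeal k (excess L M)).map f by rw [h]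
  have hmem : ∀ v, f v ∈ (Submodule.pi Set.univ fun p => Trunc.powIdeal k (below M (L p))) ↔
      v ∈ Trunc.powIdeal k (excess L M) := fun v => by
    have h1 : ∀ p, f v p ∈ Trunc.powIdeal k (below M (L p)) ↔
        v ∈ Trunc.powIdeal k (below M (L p) - p) := fun p =>
      Trunc.tvar_pow_mul_mem_iff (below_le M _) v
    constructor
    · intro h
      obtain ⟨p, -, hp⟩ := Finset.exists_mem_eq_sup Finset.univ ⟨⟨0, hk⟩, Finset.mem_univ _⟩
        (fun p : Fin k => below M (L p) - p)
      rw [excess, hp]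
      exact (h1 p).1 (h p trivial)
    · intro h p _
      exact (h1 p).2 (Trunc.powIdeal_antitone
        (Finset.le_sup (f := fun p : Fin k => below M (L p) - p) (Finset.mem_univ p)) h)
  ext v
  constructor
  · rintro ⟨h1, h2⟩
    have h3 : v = f (v ⟨0, hk⟩) :=
      funext fun p => eq_tvar_pow_mul_first (fun p => congrFun h2 p) p
    rw [h3] at h1 ⊢
    exact Submodule.mem_map_of_mem ((hmem _).1 h1)
  · rintro ⟨v, hv, rfl⟩
    refine ⟨(hmem v).2 hv, funext fun p => ?_⟩
    rw [relEnd_apply, sum_relMatrix_mul]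
    split_ifs with h
    · simp only [f, LinearMap.pi_apply, LinearMap.mulLeft_apply]
      rw [pow_succ', mul_assoc, sub_self]
      rfl
    · simp only [f, LinearMap.pi_apply, LinearMap.mulLeft_apply]
      rw [← mul_assoc, ← pow_succ', Trunc.tvar_pow_eq_zero (by omega), zero_mul, sub_zero]
      rfl

theorem map_relForm_pi (hL : StrictMono L) (hM : StrictMono M) :
    (Submodule.pi Set.univ fun p => Trunc.powIdeal k (below M (L p + 1))).map (relForm k) =
      Trunc.powIdeal k (k - excess M L) := by
  rw [excess_swap hL hM]
  set s := Finset.univ.sup fun p : Fin k => (p + 1 - below M (L p + 1) : ℕ) with hs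
  apply le_antisymm
  · rintro _ ⟨w, hw, rfl⟩
    rw [relForm_apply]
    refine Submodule.sum_mem _ fun p _ => ?_
    refine Trunc.powIdeal_antitone ?_ (Trunc.tvar_pow_mul_mem (hw p trivial))
    have : (p : ℕ) + 1 - below M (L p + 1) ≤ s :=
      Finset.le_sup (f := fun p : Fin k => (p + 1 - below M (L p + 1) : ℕ)) (Finset.mem_univ p)
    omega
  · rcases Nat.eq_zero_or_pos s with h0 | h0
    · rw [h0, Nat.sub_zero, Trunc.powIdeal_self]
      exact bot_le
    · have hne : (Finset.univ : Finset (Fin k)).Nonempty := by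
        by_contra hc
        rw [Finset.not_nonempty_iff_eq_empty] at hc
        rw [hs, hc] at h0
        simp at h0
      obtain ⟨p, -, hp⟩ := Finset.exists_mem_eq_sup _ hne
        (fun p : Fin k => (p + 1 - below M (L p + 1) : ℕ))
      rw [← hs] at hp
      intro v hv
      rw [Trunc.mem_powIdeal] at hv
      obtain ⟨u, rfl⟩ := hv
      refine ⟨Pi.single p (tvar k ^ below M (L p + 1) * u), fun q _ => ?_, ?_⟩
      · by_cases hq : q = p
        · subst hq
          rw [Pi.single_eq_same]
          exact Trunc.mem_powIdeal.2 (dvd_mul_right _ _)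
        · rw [Pi.single_eq_of_ne hq]
          exact Submodule.zero_mem _
      · rw [relForm_apply, Finset.sum_eq_single p]
        · rw [Pi.single_eq_same, ← mul_assoc, ← pow_add]
          congr 2
          omega
        · intro q _ hq
          rw [Pi.single_eq_of_ne hq, mul_zero]
        · simp

theorem sum_finrank_powIdeal_below (L M : Fin k → ℤ) :
    ∑ p, Module.finrank ℂ (Trunc.powIdeal k (below M (L p + 1))) +
        ∑ p, ∑ q, (if L p = M q then 1 else 0) =
      ∑ p, Module.finrank ℂ (Trunc.powIdeal k (below M (L p))) := by
  rw [← Finset.sum_add_distrib]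
  refine Finset.sum_congr rfl fun p _ => ?_
  rw [Trunc.finrank_powIdeal (below_le _ _), Trunc.finrank_powIdeal (below_le _ _)]
  have h1 := below_add_one M (L p)
  have h2 := below_le M (L p + 1)
  omega

end Dimension

section Ext

variable {k : ℕ} (hk : 2 ≤ k) (ℓ m : Finset ℤ) (hℓ : ℓ.card = k) (hm : m.card = k)

theorem finite_hom_syzygy :
    Module.Finite ℂ (syzygy (coverMap hk ℓ hℓ) ⟶ subsetModule hk m hm) :=
  Module.Finite.of_injective _ (evalSyzygy_injective hk ℓ m hℓ hm)

theorem finite_ext :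
    Module.Finite ℂ (Ext1 (subsetModule hk ℓ hℓ) (subsetModule hk m hm)) := by
  have := finite_hom_syzygy hk ℓ m hℓ hm
  obtain ⟨δ, hδ, -⟩ := exists_surjective_ext (coverMap hk ℓ hℓ) (coverMap_surjective hk ℓ hℓ)
    (subsetModule hk m hm)
  exact Module.Finite.of_surjective δ hδ

theorem finrank_ext_add :
    Module.finrank ℂ (Ext1 (subsetModule hk ℓ hℓ) (subsetModule hk m hm)) +
      Module.finrank ℂ ((Submodule.pi Set.univ fun p =>
        Trunc.powIdeal k (below (enum m hm) (enum ℓ hℓ p))).map (relEnd k)) =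
    Module.finrank ℂ ↥((Submodule.pi Set.univ fun p =>
      Trunc.powIdeal k (below (enum m hm) (enum ℓ hℓ p + 1))) ⊓ LinearMap.ker (relForm k)) := by
  have := finite_hom_syzygy hk ℓ m hℓ hm
  obtain ⟨δ, hδ, hker⟩ := exists_surjective_ext (coverMap hk ℓ hℓ)
    (coverMap_surjective hk ℓ hℓ) (subsetModule hk m hm)
  have hinj := evalSyzygy_injective hk ℓ m hℓ hm
  have h1 := LinearMap.finrank_range_add_finrank_ker δ
  have h2 : (LinearMap.ker δ).map (evalSyzygy hk ℓ m hℓ hm) = (Submodule.pi Set.univ fun p =>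
        Trunc.powIdeal k (below (enum m hm) (enum ℓ hℓ p))).map (relEnd k) := by
    rw [← range_evalCover hk, hker, ← LinearMap.range_comp, ← LinearMap.range_comp]
    congr 1
    exact LinearMap.ext (evalSyzygy_restrict hk ℓ m hℓ hm)
  rw [LinearMap.range_eq_top.2 hδ, finrank_top] at h1
  rw [← h2, ← range_evalSyzygy hk, LinearMap.finrank_range_of_inj hinj, ← h1,
    ← (Submodule.equivMapOfInjective _ hinj (LinearMap.ker δ)).finrank_eq]

/-- The dimension of `Ext¹(I(ℓ), I(m))` by a formula that is symmetric in `ℓ` and `m`: the double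
sum counts the common elements. -/
theorem finrank_ext_formula :
    Module.finrank ℂ (Ext1 (subsetModule hk ℓ hℓ) (subsetModule hk m hm)) +
      (excess (enum ℓ hℓ) (enum m hm) + excess (enum m hm) (enum ℓ hℓ)) +
      ∑ p, ∑ q, (if enum ℓ hℓ p = enum m hm q then 1 else 0) = k := by
  have h1 := finrank_ext_add hk ℓ m hℓ hm
  have h2 := finrank_map_add_finrank_inf_ker (relEnd k) (Submodule.pi Set.univ fun p =>
    Trunc.powIdeal k (below (enum m hm) (enum ℓ hℓ p)))
  have h3 := finrank_map_add_finrank_inf_ker (relForm k) (Submodule.pi Set.univ fun p =>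
    Trunc.powIdeal k (below (enum m hm) (enum ℓ hℓ p + 1)))
  rw [finrank_pi_inf_ker_relEnd (by omega), finrank_pi_univ] at h2
  rw [map_relForm_pi (enum_strictMono ℓ hℓ) (enum_strictMono m hm),
    Trunc.finrank_powIdeal (Nat.sub_le _ _), finrank_pi_univ] at h3
  have h4 := sum_finrank_powIdeal_below (enum ℓ hℓ) (enum m hm)
  have h5 := excess_le (enum ℓ hℓ) (enum m hm)
  have h6 := excess_le (enum m hm) (enum ℓ hℓ)
  omega

theorem finrank_ext_comm :
    Module.finrank ℂ (Ext1 (subsetModule hk ℓ hℓ) (subsetModule hk m hm)) =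
      Module.finrank ℂ (Ext1 (subsetModule hk m hm) (subsetModule hk ℓ hℓ)) := by
  have h1 := finrank_ext_formula hk ℓ m hℓ hm
  have h2 := finrank_ext_formula hk m ℓ hm hℓ
  rw [Finset.sum_comm] at h2
  simp only [eq_comm (a := enum m hm _)] at h2
  omega

end Ext

end GrassmannInfinite

end

theorem corollary4p13 (k : ℕ) (hk : 2 ≤ k) (ℓ m : Finset ℤ) (hℓ : ℓ.card = k)
    (hm : m.card = k) :
    Module.Finite ℂ (GrassmannInfinite.Ext1 (GrassmannInfinite.subsetModule hk ℓ hℓ)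
        (GrassmannInfinite.subsetModule hk m hm)) ∧
      Module.Finite ℂ (GrassmannInfinite.Ext1 (GrassmannInfinite.subsetModule hk m hm)
        (GrassmannInfinite.subsetModule hk ℓ hℓ)) ∧
      Module.finrank ℂ (GrassmannInfinite.Ext1 (GrassmannInfinite.subsetModule hk ℓ hℓ)
          (GrassmannInfinite.subsetModule hk m hm)) =
        Module.finrank ℂ (GrassmannInfinite.Ext1 (GrassmannInfinite.subsetModule hk m hm)
          (GrassmannInfinite.subsetModule hk ℓ hℓ)) :=
  ⟨GrassmannInfinite.finite_ext hk ℓ m hℓ hm, GrassmannInfinite.finite_ext hk m ℓ hm hℓ,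
    GrassmannInfinite.finrank_ext_comm hk ℓ m hℓ hm⟩
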